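/- Let $K$ be a field and let $A=KQ/I$ be a finite dimensional string algebra: $Q$ is a finite quiver with at most two arrows entering and at most two arrows leaving each vertex; $I$ is an ideal generated by a set $\rho$ of paths of length $\ge 2$ such that every sufficiently long path has a subpath in $\rho$; and for every arrow $\beta$ there is at most one arrow $\alpha$ such that $\beta\alpha$ is a path not in $\rho$, and at most one arrow $\gamma$ such that $\gamma\beta$ is a path not in $\rho$. Paths are composed from right to left and modules are left modules. A letter is an arrow (direct letter) or the formal inverse of an arrow (inverse letter). A (finite) string is a walk, written as a word in letters from left to right, where a direct letter $\alpha$ goes from the target of $\alpha$ to its source and an inverse letter $\beta^{-1}$ from the source of $\beta$ to its target, in which no letter stands next to its inverse and which contains no element of $\rho$ and no inverse of such an element as a subword. A band is a string of the form $\alpha u\beta^{-1}$, with $\alpha\neq\beta$ arrows having the same target, that is not a proper power $v^k$, $k\ge 2$. Assume that $A$ is domestic: for every arrow $\alpha$ there is at most one band starting with $\alpha$. For each vertex $S$ distribute the letters starting at $S$ (arrows with target $S$, inverses of arrows with source $S$) between two sides $1$ and $-1$, so that each side contains at most one direct and at most one inverse letter, and $\beta\alpha\in\rho$ whenever $\alpha$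 and $\beta^{-1}$ are on the same side. Let $H_i(S)$ consist of the empty string $1_{S,i}$ and the strings whose first letter starts at $S$ and is on side $i$, and let $\widehat H_i(S)\supseteq H_i(S)$ be the set of all finite or one-sided infinite words all of whose finite initial subwords lie in $H_i(S)$. Order $\widehat H_i(S)$ linearly by comparing two words at the first place where they differ, where (inverse letter) $<$ (end of word) $<$ (direct letter). Let $M$ be an $A$-module. For an additive subgroup $N\subseteq M$ and an arrow $\alpha$ let $\alpha N$ and $\alpha^{-1}N$ be the image and the preimage of $N$ under multiplication by $\alpha$, and define $DN$ for a finite string $D$ by applying its letters successively, the rightmost first. For $D\in H_i(S)$ say that $x\in e_SM$ is divisible by $D$ if $x\in D\gamma^{-1}(0)$, in case there is an arrow $\gamma$ (necessarily unique) with $D\gamma^{-1}\in H_i(S)$, and if $x\in DM$, in case there is no such arrow. For $x\in e_SM$ let the right string $v(x)\in\widehat H_1(S)$ and the left string $u(x)\in\widehat H_{-1}(S)$ be the suprema of the $D\in H_1(S)$, respectively $D\in H_{-1}(S)$, by which $x$ is divisible. A nonzero element $m\in e_SM$ is homogeneous if there is no $x\in e_SM$ with $u(x)>u(m)$ and $v(m-x)>v(m)$.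 Then every nonzero pure injective $A$-module $M$ (that is, every nonzero direct summand of a direct product of finite dimensional $A$-modules) contains a homogeneous element: there are a vertex $S$ and a homogeneous element $m\in e_SM$. -/

import Mathlib

universe uK uV uE uM uI uN

namespace StringAlg

/-! ### Quivers with monomial relations

Arrows of a quiver are the elements `a` of `Quiver.Total V`, with source `a.left` and target
`a.right`.  Paths are composed from right to left: in the word `[b, a]` one goes first along `a`
and then along `b`. -/

section Quivers

variable {V : Type uV} [Quiver.{uE} V]

/-- A word in the arrows is a path if consecutive arrows compose (from right to left). -/
def IsPath (p : List (Quiver.Total V)) : Prop :=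
  p.IsChain fun b a => b.left = a.right

/-- The set `ρ` of monomial relations presents a finite dimensional string algebra: `ρ` consists of
paths of length at least two and contains a subpath of every sufficiently long path, at most two
arrows enter and at most two arrows leave each vertex, and for each arrow there is at most one
arrow that can be composed with it on a given side to a nonzero path of length two. -/
structure IsStringPresentation (ρ : Set (List (Quiver.Total V))) : Prop where
  isPath : ∀ r ∈ ρ, IsPath r
  two_le_length : ∀ r ∈ ρ, 2 ≤ r.length
  bounded : ∃ n : ℕ, ∀ p : List (Quiver.Total V), IsPath p → n ≤ p.length → ∃ r ∈ ρ, r <:+: p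
  ingoing : ∀ x : V, {a : Quiver.Total V | a.right = x}.encard ≤ 2
  outgoing : ∀ x : V, {a : Quiver.Total V | a.left = x}.encard ≤ 2
  unique_before : ∀ b a a' : Quiver.Total V, b.left = a.right → b.left = a'.right →
    [b, a] ∉ ρ → [b, a'] ∉ ρ → a = a'
  unique_after : ∀ a b b' : Quiver.Total V, b.left = a.right → b'.left = a.right →
    [b, a] ∉ ρ → [b', a] ∉ ρ → b = b'

end Quivers

/-! ### The algebra `KQ/I` -/

section Algebra

variable (K : Type uK) [Field K] {V : Type uV} [Quiver.{uE} V] [Fintype V]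

/-- The defining relations of the bound quiver algebra `KQ/I`, `I` generated by `ρ`, on the
generators `e_x` (`x` a vertex) and the arrows. -/
inductive BoundRel (ρ : Set (List (Quiver.Total V))) :
    FreeAlgebra K (V ⊕ Quiver.Total V) → FreeAlgebra K (V ⊕ Quiver.Total V) → Prop
  | idem (x : V) : BoundRel ρ
      (FreeAlgebra.ι K (Sum.inl x) * FreeAlgebra.ι K (Sum.inl x)) (FreeAlgebra.ι K (Sum.inl x))
  | orth (x y : V) (h : x ≠ y) : BoundRel ρ
      (FreeAlgebra.ι K (Sum.inl x) * FreeAlgebra.ι K (Sum.inl y)) 0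
  | one : BoundRel ρ (∑ x : V, FreeAlgebra.ι K (Sum.inl x)) 1
  | target (a : Quiver.Total V) : BoundRel ρ
      (FreeAlgebra.ι K (Sum.inl a.right) * FreeAlgebra.ι K (Sum.inr a))
      (FreeAlgebra.ι K (Sum.inr a))
  | source (a : Quiver.Total V) : BoundRel ρ
      (FreeAlgebra.ι K (Sum.inr a) * FreeAlgebra.ι K (Sum.inl a.left))
      (FreeAlgebra.ι K (Sum.inr a))
  | rel (r : List (Quiver.Total V)) (h : r ∈ ρ) : BoundRel ρ
      (r.map fun a => FreeAlgebra.ι K (Sum.inr a)).prod 0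

/-- The bound quiver algebra `KQ/I`, where `I` is the ideal generated by the paths in `ρ`. -/
abbrev BoundQuiverAlgebra (ρ : Set (List (Quiver.Total V))) := RingQuot (BoundRel K ρ)

/-- The idempotent `e_x` of the vertex `x`. -/
noncomputable def vertex (ρ : Set (List (Quiver.Total V))) (x : V) : BoundQuiverAlgebra K ρ :=
  RingQuot.mkAlgHom K (BoundRel K ρ) (FreeAlgebra.ι K (Sum.inl x))

/-- The class of an arrow in `KQ/I`. -/
noncomputable def arrow (ρ : Set (List (Quiver.Total V))) (a : Quiver.Total V) :
    BoundQuiverAlgebra K ρ :=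
  RingQuot.mkAlgHom K (BoundRel K ρ) (FreeAlgebra.ι K (Sum.inr a))

end Algebra

/-! ### Pure injective modules -/

/-- A left module over the `K`-algebra `A` that is finite dimensional over `K`. -/
structure FinDimModule (K : Type uK) [Field K] (A : Type uV) [Ring A] [Algebra K A] where
  carrier : Type uN
  [addCommGroup : AddCommGroup carrier]
  [moduleBase : Module K carrier]
  [module : Module A carrier]
  [isScalarTower : IsScalarTower K A carrier]
  [finiteDimensional : FiniteDimensional K carrier]

attribute [instance] FinDimModule.addCommGroup FinDimModule.moduleBase FinDimModule.module
  FinDimModule.isScalarTower FinDimModule.finiteDimensional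

/-- A module over a finite dimensional `K`-algebra `A` is pure injective if it is a direct summand
of a direct product of finite dimensional modules. -/
def IsPureInjective (K : Type uK) [Field K] (A : Type uV) [Ring A] [Algebra K A]
    (M : Type uM) [AddCommGroup M] [Module A M] : Prop :=
  ∃ (ι : Type uI) (N : ι → FinDimModule.{uK, uV, uN} K A)
    (f : M →ₗ[A] (∀ i, (N i).carrier)) (g : (∀ i, (N i).carrier) →ₗ[A] M),
    g ∘ₗ f = LinearMap.id

/-! ### Letters, strings, bands -/

section Strings

/-- A letter is an arrow (direct letter) or the formal inverse of an arrow (inverse letter). -/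
inductive Letter (V : Type uV) [Quiver.{uE} V] : Type (max uV uE)
  | direct (a : Quiver.Total V) : Letter V
  | inverse (a : Quiver.Total V) : Letter V

variable {V : Type uV} [Quiver.{uE} V]

/-- The formal inverse of a letter. -/
def Letter.inv : Letter V → Letter V
  | direct a => inverse a
  | inverse a => direct a

/-- The vertex at the left end of a letter; a direct letter points from right to left. -/
def Letter.leftEnd : Letter V → V
  | direct a => a.right
  | inverse a => a.left

/-- The vertex at the right end of a letter. -/
def Letter.rightEnd : Letter V → V
  | direct a => a.left
  | inverse a => a.right

/-- A finite word is a string if it is a walk in the quiver without cancellation that contains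
neither a relation nor the inverse of a relation as a subword. -/
def IsString (ρ : Set (List (Quiver.Total V))) (w : List (Letter V)) : Prop :=
  (w.IsChain fun l l' => l.rightEnd = l'.leftEnd ∧ l' ≠ l.inv) ∧
    ∀ r ∈ ρ, ¬ (r.map Letter.direct) <:+: w ∧ ¬ (r.reverse.map Letter.inverse) <:+: w

/-- A band is a primitive string of the form `α u β⁻¹`, where `α ≠ β` are arrows with the same
target. -/
def IsBand (ρ : Set (List (Quiver.Total V))) (C : List (Letter V)) : Prop :=
  IsString ρ C ∧
    (∃ (α β : Quiver.Total V) (u : List (Letter V)), α ≠ β ∧ α.right = β.right ∧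
      C = Letter.direct α :: (u ++ [Letter.inverse β])) ∧
    ∀ (v : List (Letter V)) (k : ℕ), 2 ≤ k → C ≠ (List.replicate k v).flatten

/-- Domesticity: for every arrow there is at most one band starting with it. -/
def IsDomestic (ρ : Set (List (Quiver.Total V))) : Prop :=
  ∀ (α : Quiver.Total V) (C C' : List (Letter V)), IsBand ρ C → IsBand ρ C' →
    C.head? = some (Letter.direct α) → C'.head? = some (Letter.direct α) → C = C'

/-- An admissible distribution of the letters with left end `x`, for each vertex `x`, between the
two sides `1` and `-1`: each side gets at most one direct and at most one inverse letter, and if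
it gets both `a` and `b⁻¹`, then the path `ba` is a relation. -/
structure IsSidePartition (ρ : Set (List (Quiver.Total V))) (side : Letter V → ℤˣ) : Prop where
  direct : ∀ a a' : Quiver.Total V, a.right = a'.right →
    side (Letter.direct a) = side (Letter.direct a') → a = a'
  inverse : ∀ b b' : Quiver.Total V, b.left = b'.left →
    side (Letter.inverse b) = side (Letter.inverse b') → b = b'
  rel : ∀ a b : Quiver.Total V, a.right = b.left →
    side (Letter.direct a) = side (Letter.inverse b) → [b, a] ∈ ρ

/-- The word `D` is in `H_i(S)`: it is a string, and its first letter, if there is one, has left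
end `S` and lies on the side `i`.  The empty word stands for `1_{S,i}`. -/
def IsInH (ρ : Set (List (Quiver.Total V))) (side : Letter V → ℤˣ) (S : V) (i : ℤˣ)
    (D : List (Letter V)) : Prop :=
  IsString ρ D ∧ ∀ l, D.head? = some l → l.leftEnd = S ∧ side l = i

/-- The set of finite or infinite one-sided strings that extends `H_i(S)`, i.e. of the finite or
infinite words all of whose finite initial subwords are in `H_i(S)`. -/
def HHat (ρ : Set (List (Quiver.Total V))) (side : Letter V → ℤˣ) (S : V) (i : ℤˣ) :
    Type (max uV uE) :=
  {s : Stream'.Seq (Letter V) // ∀ n : ℕ, IsInH ρ side S i (s.take n)}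

/-- The order at one position: inverse letter `<` end of the word `<` direct letter. -/
def letterRank : Option (Letter V) → ℤ
  | some (Letter.inverse _) => -1
  | none => 0
  | some (Letter.direct _) => 1

/-- One-sided strings are compared at the first position where they differ. -/
instance HHat.instLT (ρ : Set (List (Quiver.Total V))) (side : Letter V → ℤˣ) (S : V) (i : ℤˣ) :
    LT (HHat ρ side S i) where
  lt s t := ∃ n : ℕ, (∀ k < n, s.1.get? k = t.1.get? k) ∧
    letterRank (s.1.get? n) < letterRank (t.1.get? n)

instance HHat.instLE (ρ : Set (List (Quiver.Total V))) (side : Letter V → ℤˣ) (S : V) (i : ℤˣ) :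
    LE (HHat ρ side S i) where
  le s t := s < t ∨ s = t

end Strings

/-! ### Strings of elements and homogeneous elements -/

section Elements

variable (K : Type uK) [Field K] {V : Type uV} [Quiver.{uE} V] [Fintype V]
  (ρ : Set (List (Quiver.Total V)))
  {M : Type uM} [AddCommGroup M] [Module (BoundQuiverAlgebra K ρ) M]

/-- The subspace `D N` of `M`: a direct letter acts by taking the image, an inverse letter by taking
the preimage. -/
noncomputable def wordAct : List (Letter V) → AddSubgroup M → AddSubgroup M
  | [], N => N
  | Letter.direct a :: D, N =>
      (wordAct D N).map (DistribSMul.toAddMonoidHom M (arrow K ρ a))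
  | Letter.inverse a :: D, N =>
      (wordAct D N).comap (DistribSMul.toAddMonoidHom M (arrow K ρ a))

variable (side : Letter V → ℤˣ) (S : V) (i : ℤˣ)

/-- The pp formula attached to `D ∈ H_i(S)` (it is `(.D)` for `i = 1` and `(D⁻¹.)` for `i = -1`):
`x = e_S x`, and `x ∈ D γ⁻¹(0)` if there is an arrow `γ` such that `D γ⁻¹` is a string in `H_i(S)`
(there is at most one), respectively `x ∈ D M` if there is no such arrow. -/
def Formula (D : List (Letter V)) (x : M) : Prop :=
  vertex K ρ S • x = x ∧
    ((∃ γ : Quiver.Total V, IsInH ρ side S i (D ++ [Letter.inverse γ]) ∧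
        x ∈ wordAct K ρ (D ++ [Letter.inverse γ]) ⊥) ∨
      ((¬ ∃ γ : Quiver.Total V, IsInH ρ side S i (D ++ [Letter.inverse γ])) ∧
        x ∈ wordAct K ρ D ⊤))

/-- `s` is the string of `m ∈ e_S M` on the side `i` (right handed string for `i = 1`, left handed
string for `i = -1`): the supremum of the finite strings in `H_i(S)` whose formula holds for `m`. -/
def IsStringOf (m : M) (s : HHat ρ side S i) : Prop :=
  IsLUB {t : HHat ρ side S i |
    ∃ D : List (Letter V), t.1 = Stream'.Seq.ofList D ∧ Formula K ρ side S i D m} s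

/-- A nonzero element `m ∈ e_S M` with left string `u` and right string `v` is homogeneous if there
is no `x ∈ e_S M` such that the left string of `x` is greater than `u` and the right string of
`m - x` is greater than `v`. -/
def IsHomogeneous (m : M) : Prop :=
  m ≠ 0 ∧ vertex K ρ S • m = m ∧
    ∃ (u : HHat ρ side S (-1)) (v : HHat ρ side S 1),
      IsStringOf K ρ side S (-1) m u ∧ IsStringOf K ρ side S 1 m v ∧
      ¬ ∃ x : M, vertex K ρ S • x = x ∧
        ∃ (u' : HHat ρ side S (-1)) (v' : HHat ρ side S 1),
          IsStringOf K ρ side S (-1) x u' ∧ IsStringOf K ρ side S 1 (m - x) v' ∧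
          u < u' ∧ v < v'

end Elements

end StringAlg

/-! Suppose that no element is homogeneous. The formulas of the finite words in `H_i(S)` are
linearly ordered by implication (`Formula.mono`), and pure injectivity makes it possible to satisfy
any set of them simultaneously inside a coset as soon as each one is satisfiable there
(`IsPureInjective.exists_forall_formula`).

Let one string of a nonzero element m be a finite word D. If D is the largest finite word, m is
homogeneous. Otherwise D has an immediate successor E (`exists_successor`). By compactness some y in
the coset of m modulo the solutions of E has the largest string on the other side. It keeps the
string D and is homogeneous, because any x with a string above D solves E, so that y - x lies in the
same coset (`exists_isHomogeneousOn_of_finite`). Hence all strings of nonzero elements are infinite.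

The infinite words that occur as strings of nonzero elements are closed under deleting the first
letter (`exists_strip`, `IsRealized.tail`). For a set of infinite words with this property,
domesticity provides a member that no other member exceeds (`exists_maximal_word`): from a suitable
starting arrow, a larger member could be led back to that arrow, giving two closed words neither of
which extends the other, although both are powers of the only band there. An element whose string is
this maximal word is homogeneous: a competitor x would be nonzero with a larger infinite string. -/

namespace StringAlg

/-! ### Continuations of strings, and the complete linear order on one-sided strings -/

section Words

variable {V : Type uV} [Quiver.{uE} V] {ρ : Set (List (Quiver.Total V))}
  {side : Letter V → ℤˣ} {S : V} {i : ℤˣ}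

theorem IsString.infix {w w' : List (Letter V)} (h : IsString ρ w) (h' : w' <:+: w) :
    IsString ρ w' :=
  ⟨h.1.infix h', fun r hr => ⟨fun x => (h.2 r hr).1 (x.trans h'), fun x => (h.2 r hr).2 (x.trans h')⟩⟩

theorem isString_pair_iff (hρ : IsStringPresentation ρ) {l l' : Letter V} :
    IsString ρ [l, l'] ↔ l.rightEnd = l'.leftEnd ∧ l' ≠ l.inv ∧
      ∀ a b, [b, a] ∈ ρ → ¬ (l = .direct b ∧ l' = .direct a) ∧
        ¬ (l = .inverse a ∧ l' = .inverse b) := by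
  constructor
  · rintro ⟨h, h'⟩
    simp only [List.isChain_cons_cons, List.IsChain.singleton, and_true] at h
    refine ⟨h.1, h.2, fun a b hab => ⟨?_, ?_⟩⟩
    · rintro ⟨rfl, rfl⟩
      exact (h' _ hab).1 (by simp)
    · rintro ⟨rfl, rfl⟩
      exact (h' _ hab).2 (by simp)
  · rintro ⟨h1, h2, h3⟩
    refine ⟨by simpa using ⟨h1, h2⟩, fun r hr => ?_⟩
    have h2 := hρ.two_le_length r hr
    constructor
    · intro h
      have hl := h.length_le
      simp only [List.length_map, List.length_cons, List.length_nil] at hl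
      obtain ⟨b, a, rfl⟩ := List.length_eq_two.1 (by omega : r.length = 2)
      have := h.eq_of_length (by simp)
      simp only [List.map_cons, List.map_nil, List.cons.injEq, and_true] at this
      exact (h3 a b hr).1 ⟨this.1.symm, this.2.symm⟩
    · intro h
      have hl := h.length_le
      simp only [List.length_map, List.length_reverse, List.length_cons, List.length_nil] at hl
      obtain ⟨b, a, rfl⟩ := List.length_eq_two.1 (by omega : r.length = 2)
      have := h.eq_of_length (by simp)
      simp only [List.reverse_cons, List.reverse_nil, List.nil_append, List.cons_append,
        List.map_cons, List.map_nil, List.cons.injEq, and_true] at this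
      exact (h3 a b hr).2 ⟨this.1.symm, this.2.symm⟩

theorem eq_of_encard_le_two {α : Type*} {s : Set α} (hs : s.encard ≤ 2) {a b c : α} (ha : a ∈ s)
    (hb : b ∈ s) (hc : c ∈ s) (hab : b ≠ a) (hac : c ≠ a) : b = c := by
  by_contra hbc
  have h3 : ({a, b, c} : Set α).encard = 3 :=
    Set.encard_eq_three.2 ⟨a, b, c, hab.symm, hac.symm, hbc, rfl⟩
  have hsub : ({a, b, c} : Set α) ⊆ s := by
    rintro x (rfl | rfl | rfl) <;> assumption
  have := (Set.encard_le_encard hsub).trans hs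
  rw [h3] at this
  exact absurd this (by decide)

/-- If both letters point the same way as `d`, uniqueness of nonzero compositions applies. If they
point the other way, their arrows share an end vertex with the arrow of `d` and differ from it, and
at most two arrows are available. -/
theorem IsString.pair_unique (hρ : IsStringPresentation ρ) {d l l' : Letter V}
    (h : IsString ρ [d, l]) (h' : IsString ρ [d, l'])
    (hr : letterRank (some l) = letterRank (some l')) : l = l' := by
  rw [isString_pair_iff hρ] at h h'
  obtain ⟨h1, h2, h3⟩ := h
  obtain ⟨h1', h2', h3'⟩ := h'
  cases d with
  | direct d =>
    cases l with
    | direct a =>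
      cases l' with
      | direct a' =>
        rw [hρ.unique_before d a a' h1 h1' (fun hh => (h3 _ _ hh).1 ⟨rfl, rfl⟩)
          (fun hh => (h3' _ _ hh).1 ⟨rfl, rfl⟩)]
      | inverse b' => simp [letterRank] at hr
    | inverse b =>
      cases l' with
      | direct a' => simp [letterRank] at hr
      | inverse b' =>
        rw [eq_of_encard_le_two (hρ.outgoing d.left) (a := d) rfl h1.symm h1'.symm
          (fun hh => h2 (by rw [hh]; rfl)) (fun hh => h2' (by rw [hh]; rfl))]
  | inverse d =>
    cases l with
    | direct a =>
      cases l' with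
      | direct a' =>
        rw [eq_of_encard_le_two (hρ.ingoing d.right) (a := d) rfl h1.symm h1'.symm
          (fun hh => h2 (by rw [hh]; rfl)) (fun hh => h2' (by rw [hh]; rfl))]
      | inverse b' => simp [letterRank] at hr
    | inverse b =>
      cases l' with
      | direct a' => simp [letterRank] at hr
      | inverse b' =>
        rw [hρ.unique_after d b b' h1.symm h1'.symm (fun hh => (h3 _ _ hh).2 ⟨rfl, rfl⟩)
          (fun hh => (h3' _ _ hh).2 ⟨rfl, rfl⟩)]

/-- If `ca` were not in `ρ`, uniqueness of nonzero compositions would identify the arrow of `d` with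
`c` or with `a`, and one of the two words would cancel. -/
theorem IsString.pair_rel (hρ : IsStringPresentation ρ) {d : Letter V} {a c : Quiver.Total V}
    (h : IsString ρ [d, .direct a]) (h' : IsString ρ [d, .inverse c]) : [c, a] ∈ ρ := by
  rw [isString_pair_iff hρ] at h h'
  obtain ⟨h1, h2, h3⟩ := h
  obtain ⟨h1', h2', h3'⟩ := h'
  by_contra hca
  cases d with
  | direct d =>
    exact h2' (by rw [hρ.unique_after a c d (h1'.symm.trans h1) h1 hca
      (fun hh => (h3 _ _ hh).1 ⟨rfl, rfl⟩)]; rfl)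
  | inverse d =>
    exact h2 (by rw [hρ.unique_before c a d (h1'.symm.trans h1) h1'.symm hca
      (fun hh => (h3' _ _ hh).2 ⟨rfl, rfl⟩)]; rfl)

theorem IsInH.prefix {D D' : List (Letter V)} (h : IsInH ρ side S i D) (h' : D' <+: D) :
    IsInH ρ side S i D' := by
  refine ⟨h.1.infix h'.isInfix, fun l hl => h.2 l ?_⟩
  obtain ⟨t, rfl⟩ := h'
  simp [List.head?_append, hl]

theorem isInH_nil (hρ : IsStringPresentation ρ) : IsInH ρ side S i [] := by
  refine ⟨⟨List.IsChain.nil, fun r hr => ?_⟩, by simp⟩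
  have := hρ.two_le_length r hr
  constructor <;>
  · intro h
    have := h.length_le
    simp only [List.length_map, List.length_reverse, List.length_nil] at this
    omega

theorem IsInH.concat_pair {C : List (Letter V)} {d l : Letter V}
    (h : IsInH ρ side S i ((C ++ [d]) ++ [l])) : IsString ρ [d, l] :=
  h.1.infix ⟨C, [], by simp⟩

theorem IsInH.letter_unique (hρ : IsStringPresentation ρ) (hside : IsSidePartition ρ side)
    {C : List (Letter V)} {l l' : Letter V} (h : IsInH ρ side S i (C ++ [l]))
    (h' : IsInH ρ side S i (C ++ [l'])) (hr : letterRank (some l) = letterRank (some l')) :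
    l = l' := by
  rcases List.eq_nil_or_concat' C with rfl | ⟨C, d, rfl⟩
  · obtain ⟨h1, h2⟩ := h.2 l rfl
    obtain ⟨h1', h2'⟩ := h'.2 l' rfl
    cases l with
    | direct a =>
      cases l' with
      | direct a' => rw [hside.direct a a' (h1.trans h1'.symm) (h2.trans h2'.symm)]
      | inverse b' => simp [letterRank] at hr
    | inverse b =>
      cases l' with
      | direct a' => simp [letterRank] at hr
      | inverse b' => rw [hside.inverse b b' (h1.trans h1'.symm) (h2.trans h2'.symm)]
  · exact h.concat_pair.pair_unique hρ h'.concat_pair hr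

/-- This relation puts the image of `a` inside the kernel of `c`, which is why the formulas form a
chain. -/
theorem IsInH.rel_of_concat (hρ : IsStringPresentation ρ) (hside : IsSidePartition ρ side)
    {C : List (Letter V)} {a c : Quiver.Total V} (h : IsInH ρ side S i (C ++ [.direct a]))
    (h' : IsInH ρ side S i (C ++ [.inverse c])) : [c, a] ∈ ρ := by
  rcases List.eq_nil_or_concat' C with rfl | ⟨C, d, rfl⟩
  · obtain ⟨h1, h2⟩ := h.2 _ rfl
    obtain ⟨h1', h2'⟩ := h'.2 _ rfl
    exact hside.rel a c (h1.trans h1'.symm) (h2.trans h2'.symm)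
  · exact h.concat_pair.pair_rel hρ h'.concat_pair

theorem IsString.isPath_of_direct {p : List (Quiver.Total V)}
    (h : IsString ρ (p.map .direct)) : IsPath p := by
  have := h.1
  rw [List.isChain_map] at this
  exact this.imp fun _ _ h => h.1

theorem IsString.isPath_of_inverse {p : List (Quiver.Total V)}
    (h : IsString ρ (p.map .inverse)) : IsPath p.reverse := by
  have := h.1
  rw [List.isChain_map] at this
  exact List.isChain_reverse.2 (this.imp fun _ _ h => h.1.symm)

/-- Strings consisting of direct letters only, or of inverse letters only, have bounded length. -/
theorem exists_length_bound (hρ : IsStringPresentation ρ) : ∃ n : ℕ, ∀ p : List (Quiver.Total V),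
    (IsString ρ (p.map .direct) → p.length < n) ∧ (IsString ρ (p.map .inverse) → p.length < n) := by
  obtain ⟨n, hn⟩ := hρ.bounded
  refine ⟨n, fun p => ⟨fun h => ?_, fun h => ?_⟩⟩
  · by_contra! hp
    obtain ⟨r, hr, hrp⟩ := hn p h.isPath_of_direct hp
    exact (h.2 r hr).1 (hrp.map _)
  · by_contra! hp
    obtain ⟨r, hr, hrp⟩ := hn p.reverse h.isPath_of_inverse (by simpa using hp)
    refine (h.2 r hr).2 (List.IsInfix.map _ ?_)
    rwa [← List.reverse_infix, List.reverse_reverse]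

/-- Every word in `H_i(S)` has an extension by inverse letters that is maximal. -/
theorem exists_maximal_inverse_extension (hρ : IsStringPresentation ρ) {C : List (Letter V)}
    (hC : IsInH ρ side S i C) : ∃ q : List (Quiver.Total V),
      IsInH ρ side S i (C ++ q.map .inverse) ∧
      ¬ ∃ c, IsInH ρ side S i (C ++ q.map .inverse ++ [.inverse c]) := by
  obtain ⟨n, hn⟩ := exists_length_bound hρ
  by_contra! hcon
  have key : ∀ k : ℕ, ∃ q : List (Quiver.Total V), q.length = k ∧
      IsInH ρ side S i (C ++ q.map .inverse) := by
    intro k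
    induction k with
    | zero => exact ⟨[], rfl, by simpa using hC⟩
    | succ k ih =>
      obtain ⟨q, hq, hq'⟩ := ih
      obtain ⟨c, hc⟩ := hcon q hq'
      exact ⟨q ++ [c], by simp [hq], by simpa using hc⟩
  obtain ⟨q, hq, hq'⟩ := key n
  have := (hn q).2 (hq'.1.infix (List.suffix_append _ _).isInfix)
  omega

/-! ### The linear order on one-sided strings -/

theorem letterRank_le_one (o : Option (Letter V)) : letterRank o ≤ 1 := by
  rcases o with _ | (_ | _) <;> simp [letterRank]

theorem neg_one_le_letterRank (o : Option (Letter V)) : -1 ≤ letterRank o := by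
  rcases o with _ | (_ | _) <;> simp [letterRank]

theorem letterRank_eq_one {o : Option (Letter V)} (h : 0 < letterRank o) :
    ∃ a, o = some (.direct a) := by
  rcases o with _ | (_ | _) <;> simp_all [letterRank]

theorem letterRank_eq_neg_one {o : Option (Letter V)} (h : letterRank o < 0) :
    ∃ a, o = some (.inverse a) := by
  rcases o with _ | (_ | _) <;> simp_all [letterRank]

theorem letterRank_eq_zero {o : Option (Letter V)} (h : letterRank o = 0) : o = none := by
  rcases o with _ | (_ | _) <;> simp_all [letterRank]

theorem HHat.take_concat (s : HHat ρ side S i) {n : ℕ} {l : Letter V} (h : s.1.get? n = some l) :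
    s.1.take (n + 1) = s.1.take n ++ [l] := by
  have hlen : (s.1.take n).length = n := by
    apply le_antisymm Stream'.Seq.length_take_le
    by_contra! hlt
    have h1 : (s.1.take n)[(s.1.take n).length]? = none := by simp
    rw [Stream'.Seq.getElem?_take, if_pos hlt] at h1
    rw [s.1.le_stable hlt.le h1] at h
    cases h
  apply List.ext_getElem?
  intro k
  rw [Stream'.Seq.getElem?_take, List.getElem?_append, hlen]
  by_cases hk : k < n
  · rw [if_pos hk, if_pos (by omega), Stream'.Seq.getElem?_take, if_pos hk]
  · rw [if_neg hk]
    by_cases hk' : k = n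
    · subst hk'; simp [h]
    · rw [if_neg (by omega)]
      rw [List.getElem?_eq_none]
      simp; omega

theorem HHat.isInH_concat (s : HHat ρ side S i) {n : ℕ} {l : Letter V}
    (h : s.1.get? n = some l) : IsInH ρ side S i (s.1.take n ++ [l]) :=
  s.take_concat h ▸ s.2 (n + 1)

theorem HHat.take_eq {s t : HHat ρ side S i} {n : ℕ} (h : ∀ k < n, s.1.get? k = t.1.get? k) :
    s.1.take n = t.1.take n := by
  apply List.ext_getElem?
  intro k
  rw [Stream'.Seq.getElem?_take, Stream'.Seq.getElem?_take]
  split_ifs with hk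
  · exact h k hk
  · rfl

theorem HHat.get?_eq (hρ : IsStringPresentation ρ) (hside : IsSidePartition ρ side)
    {s t : HHat ρ side S i} {n : ℕ} (h : ∀ k < n, s.1.get? k = t.1.get? k)
    (hr : letterRank (s.1.get? n) = letterRank (t.1.get? n)) : s.1.get? n = t.1.get? n := by
  cases hs : s.1.get? n with
  | none =>
    rw [hs] at hr
    exact (letterRank_eq_zero hr.symm).symm
  | some l =>
    cases ht : t.1.get? n with
    | none =>
      rw [ht] at hr
      rw [← hs, letterRank_eq_zero hr]
    | some l' =>
      rw [hs, ht] at hr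
      have h1 := s.isInH_concat hs
      rw [HHat.take_eq h] at h1
      rw [h1.letter_unique hρ hside (t.isInH_concat ht) hr]

/-- One-sided strings are linearly ordered. -/
noncomputable abbrev HHat.linearOrder (hρ : IsStringPresentation ρ)
    (hside : IsSidePartition ρ side) (S : V) (i : ℤˣ) : LinearOrder (HHat ρ side S i) := by
  classical
  have irrefl : ∀ s : HHat ρ side S i, ¬ s < s := fun s ⟨n, _, hn⟩ => lt_irrefl _ hn
  have trans : ∀ s t u : HHat ρ side S i, s < t → t < u → s < u := by
    rintro s t u ⟨n, hn, hn'⟩ ⟨m, hm, hm'⟩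
    rcases lt_trichotomy n m with h | rfl | h
    · exact ⟨n, fun k hk => (hn k hk).trans (hm k (hk.trans h)), hm n h ▸ hn'⟩
    · exact ⟨n, fun k hk => (hn k hk).trans (hm k hk), hn'.trans hm'⟩
    · exact ⟨m, fun k hk => (hn k (hk.trans h)).trans (hm k hk), (hn m h).symm ▸ hm'⟩
  have tri : ∀ s t : HHat ρ side S i, s < t ∨ s = t ∨ t < s := by
    intro s t
    by_cases h : ∀ n, s.1.get? n = t.1.get? n
    · exact Or.inr (Or.inl (Subtype.ext (Stream'.Seq.ext h)))
    · push Not at h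
      have h1 := Nat.find_spec h
      have h2 : ∀ k < Nat.find h, s.1.get? k = t.1.get? k := fun k hk => by
        simpa using Nat.find_min h hk
      rcases lt_trichotomy (letterRank (s.1.get? (Nat.find h)))
        (letterRank (t.1.get? (Nat.find h))) with h3 | h3 | h3
      · exact Or.inl ⟨_, h2, h3⟩
      · exact absurd (HHat.get?_eq hρ hside h2 h3) h1
      · exact Or.inr (Or.inr ⟨_, fun k hk => (h2 k hk).symm, h3⟩)
  exact
    { le := (· ≤ ·)
      lt := (· < ·)
      le_refl := fun s => Or.inr rfl
      le_trans := by
        rintro s t u (h | rfl) (h' | rfl)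
        · exact Or.inl (trans _ _ _ h h')
        · exact Or.inl h
        · exact Or.inl h'
        · exact Or.inr rfl
      lt_iff_le_not_ge := by
        intro s t
        constructor
        · refine fun h => ⟨Or.inl h, ?_⟩
          rintro (h' | rfl)
          · exact irrefl _ (trans _ _ _ h h')
          · exact irrefl _ h
        · rintro ⟨h | rfl, h'⟩
          · exact h
          · exact absurd (Or.inr rfl) h'
      le_antisymm := by
        rintro s t (h | rfl) (h' | h')
        · exact absurd (trans _ _ _ h h') (irrefl _)
        · exact h'.symm
        · rfl
        · rfl
      le_total := by
        intro s t
        rcases tri s t with h | h | h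
        · exact Or.inl (Or.inl h)
        · exact Or.inl (Or.inr h)
        · exact Or.inr (Or.inl h)
      toDecidableLE := Classical.decRel _ }

/-- A finite word in `H_i(S)` as a one-sided string. -/
def HHat.ofList (D : List (Letter V)) (h : IsInH ρ side S i D) : HHat ρ side S i :=
  ⟨Stream'.Seq.ofList D, fun n => by
    have : (Stream'.Seq.ofList D).take n = D.take n := by
      apply List.ext_getElem?
      intro k
      rw [Stream'.Seq.getElem?_take, List.getElem?_take, Stream'.Seq.ofList_get?]
    rw [this]
    exact h.prefix (List.take_prefix _ _)⟩

@[simp]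
theorem HHat.get?_ofList (D : List (Letter V)) (h : IsInH ρ side S i D) (n : ℕ) :
    (HHat.ofList D h).1.get? n = D[n]? := Stream'.Seq.ofList_get? D n

theorem HHat.isInH_of_eq_ofList (s : HHat ρ side S i) {D : List (Letter V)}
    (h : s.1 = Stream'.Seq.ofList D) : IsInH ρ side S i D := by
  have h1 := s.2 D.length
  have : s.1.take D.length = D := by
    apply List.ext_getElem?
    intro k
    rw [Stream'.Seq.getElem?_take, h, Stream'.Seq.ofList_get?]
    split_ifs with hk
    · rfl
    · rw [List.getElem?_eq_none (by omega)]
  rwa [this] at h1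

/-- Every nonempty set of one-sided strings has a supremum. -/
theorem HHat.exists_isLUB (hρ : IsStringPresentation ρ) (hside : IsSidePartition ρ side)
    {T : Set (HHat ρ side S i)} (hT : T.Nonempty) : ∃ s, IsLUB T s := by
  -- `Q n t` says that `t` is lexicographically maximal in `T` as far as the first `n` letters are
  -- concerned. The supremum is the limit of such `t`.
  let Q : ℕ → HHat ρ side S i → Prop := fun n t => t ∈ T ∧ ∀ t' ∈ T, ∀ k < n,
    (∀ j < k, t'.1.get? j = t.1.get? j) → letterRank (t'.1.get? k) ≤ letterRank (t.1.get? k)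
  have hQ : ∀ n, ∃ t, Q n t := by
    intro n
    induction n with
    | zero => exact ⟨hT.some, hT.some_mem, fun _ _ k hk => absurd hk (by omega)⟩
    | succ n ih =>
      obtain ⟨t, ht, ht'⟩ := ih
      have hmax : ∃ t₁ ∈ T, (∀ j < n, t₁.1.get? j = t.1.get? j) ∧
          ∀ t' ∈ T, (∀ j < n, t'.1.get? j = t.1.get? j) →
            letterRank (t'.1.get? n) ≤ letterRank (t₁.1.get? n) := by
        by_cases h1 : ∃ t₁ ∈ T, (∀ j < n, t₁.1.get? j = t.1.get? j) ∧
          0 < letterRank (t₁.1.get? n)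
        · obtain ⟨t₁, h1, h2, h3⟩ := h1
          exact ⟨t₁, h1, h2, fun t' _ _ => (letterRank_le_one _).trans (by omega)⟩
        by_cases h0 : ∃ t₁ ∈ T, (∀ j < n, t₁.1.get? j = t.1.get? j) ∧
          0 ≤ letterRank (t₁.1.get? n)
        · obtain ⟨t₁, h1', h2, h3⟩ := h0
          push Not at h1
          exact ⟨t₁, h1', h2, fun t' ht' h => (h1 t' ht' h).trans h3⟩
        · push Not at h0
          refine ⟨t, ht, fun _ _ => rfl, fun t' ht' h => ?_⟩
          have := h0 t' ht' h
          have := neg_one_le_letterRank (t.1.get? n)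
          omega
      obtain ⟨t₁, h1, h2, h3⟩ := hmax
      refine ⟨t₁, h1, fun t' ht'' k hk hj => ?_⟩
      rcases Nat.lt_succ_iff_lt_or_eq.1 hk with hk | rfl
      · rw [h2 k hk]
        exact ht' t' ht'' k hk fun j hjk => (hj j hjk).trans (h2 j (hjk.trans hk))
      · exact h3 t' ht'' fun j hjk => (hj j hjk).trans (h2 j hjk)
  choose t ht ht' using hQ
  have hagree : ∀ m k n, k < n → k < m → (t n).1.get? k = (t m).1.get? k := by
    intro m k
    induction k using Nat.strong_induction_on with
    | _ k ih =>
      intro n hn hm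
      have h : ∀ j < k, (t n).1.get? j = (t m).1.get? j :=
        fun j hj => ih j hj n (hj.trans hn) (hj.trans hm)
      exact HHat.get?_eq hρ hside h (le_antisymm (ht' m _ (ht n) k hm h)
        (ht' n _ (ht m) k hn fun j hj => (h j hj).symm))
  -- The index `n + 1` is the first one for which maximality controls the letter at position `n`.
  let f : Stream'.Seq (Letter V) := ⟨fun n => (t (n + 1)).1.get? n, fun {n} h => by
    change (t (n + 1 + 1)).1.get? (n + 1) = none
    apply (t (n + 2)).1.le_stable (Nat.le_succ n)
    rw [hagree (n + 1) n (n + 2) (by omega) (by omega)]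
    exact h⟩
  have hf : ∀ n k, k < n → f.get? k = (t n).1.get? k := fun n k hk =>
    hagree n k (k + 1) (by omega) hk
  have hftake : ∀ n, f.take n = (t n).1.take n := by
    intro n
    apply List.ext_getElem?
    intro k
    rw [Stream'.Seq.getElem?_take, Stream'.Seq.getElem?_take]
    split_ifs with hk
    · exact hf n k hk
    · rfl
  let s : HHat ρ side S i := ⟨f, fun n => hftake n ▸ (t n).2 n⟩
  let := HHat.linearOrder hρ hside S i
  refine ⟨s, fun t' ht'' => ?_, fun s' hs' => ?_⟩
  · by_contra hlt
    obtain ⟨n, hn, hn'⟩ := not_le.1 hlt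
    have hsn : ∀ k ≤ n, s.1.get? k = (t (n + 1)).1.get? k := fun k hk => hf _ _ (by omega)
    rw [hsn n le_rfl] at hn'
    exact absurd (ht' (n + 1) t' ht'' n (by omega)
      fun j hj => (hn j hj).symm.trans (hsn j hj.le)) (not_le.2 hn')
  · by_contra hlt
    obtain ⟨n, hn, hn'⟩ := not_le.1 hlt
    have hsn : ∀ k ≤ n, s.1.get? k = (t (n + 1)).1.get? k := fun k hk => hf _ _ (by omega)
    refine absurd (hs' (ht (n + 1))) (not_le.2 ⟨n, fun k hk => (hn k hk).trans (hsn k hk.le), ?_⟩)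
    rwa [← hsn n le_rfl]

end Words

end StringAlg

namespace StringAlg

/-! ### Words acting on modules, their formulas, and the strings of elements -/

section Action

variable {K : Type uK} [Field K] {V : Type uV} [Quiver.{uE} V] [Fintype V]
  {ρ : Set (List (Quiver.Total V))} {side : Letter V → ℤˣ} {S : V} {i : ℤˣ}
  {M : Type uM} [AddCommGroup M] [Module (BoundQuiverAlgebra K ρ) M]

theorem vertex_mul_self (S : V) : vertex K ρ S * vertex K ρ S = vertex K ρ S := by
  simpa [vertex] using RingQuot.mkAlgHom_rel K (BoundRel.idem (K := K) (ρ := ρ) S)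

theorem sum_vertex : ∑ S : V, vertex K ρ S = 1 := by
  simpa [vertex] using RingQuot.mkAlgHom_rel K (BoundRel.one (K := K) (ρ := ρ))

theorem vertex_mul_arrow (a : Quiver.Total V) :
    vertex K ρ a.right * arrow K ρ a = arrow K ρ a := by
  simpa [vertex, arrow] using RingQuot.mkAlgHom_rel K (BoundRel.target (K := K) (ρ := ρ) a)

theorem arrow_mul_vertex (a : Quiver.Total V) :
    arrow K ρ a * vertex K ρ a.left = arrow K ρ a := by
  simpa [vertex, arrow] using RingQuot.mkAlgHom_rel K (BoundRel.source (K := K) (ρ := ρ) a)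

theorem prod_arrow_eq_zero {r : List (Quiver.Total V)} (hr : r ∈ ρ) :
    (r.map (arrow K ρ)).prod = 0 := by
  have := RingQuot.mkAlgHom_rel K (BoundRel.rel (K := K) (ρ := ρ) r hr)
  rw [map_zero, map_list_prod, List.map_map] at this
  exact this

theorem wordAct_append (D E : List (Letter V)) (N : AddSubgroup M) :
    wordAct K ρ (D ++ E) N = wordAct K ρ D (wordAct K ρ E N) := by
  induction D with
  | nil => rfl
  | cons l D ih => cases l <;> simp [wordAct, ih]

theorem wordAct_mono (D : List (Letter V)) {N N' : AddSubgroup M} (h : N ≤ N') :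
    wordAct K ρ D N ≤ wordAct K ρ D N' := by
  induction D with
  | nil => exact h
  | cons l D ih =>
    cases l with
    | direct a => exact AddSubgroup.map_mono ih
    | inverse a => exact AddSubgroup.comap_mono ih

theorem mem_wordAct_direct {a : Quiver.Total V} {D : List (Letter V)} {N : AddSubgroup M} {x : M} :
    x ∈ wordAct K ρ (.direct a :: D) N ↔ ∃ y ∈ wordAct K ρ D N, arrow K ρ a • y = x := Iff.rfl

theorem mem_wordAct_inverse {a : Quiver.Total V} {D : List (Letter V)} {N : AddSubgroup M}
    {x : M} : x ∈ wordAct K ρ (.inverse a :: D) N ↔ arrow K ρ a • x ∈ wordAct K ρ D N := Iff.rfl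

theorem mem_wordAct_map_direct {p : List (Quiver.Total V)} {N : AddSubgroup M} {x : M} :
    x ∈ wordAct K ρ (p.map .direct) N ↔ ∃ y ∈ N, (p.map (arrow K ρ)).prod • y = x := by
  induction p generalizing x with
  | nil => simp [wordAct]
  | cons a p ih =>
    rw [List.map_cons, mem_wordAct_direct]
    simp only [ih, List.map_cons, List.prod_cons, mul_smul]
    aesop

theorem mem_wordAct_map_inverse {p : List (Quiver.Total V)} {N : AddSubgroup M} {x : M} :
    x ∈ wordAct K ρ (p.reverse.map .inverse) N ↔ (p.map (arrow K ρ)).prod • x ∈ N := by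
  induction p generalizing N with
  | nil => simp [wordAct]
  | cons a p ih =>
    rw [List.reverse_cons, List.map_append, wordAct_append, ih, List.map_cons (f := arrow K ρ),
      List.prod_cons, mul_smul]
    rfl

theorem wordAct_map_inverse_top (p : List (Quiver.Total V)) :
    wordAct K ρ (p.map .inverse) (⊤ : AddSubgroup M) = ⊤ := by
  ext x
  rw [← List.reverse_reverse p, mem_wordAct_map_inverse]
  simp

/-- The two subgroups to which words are applied. -/
def endSubgroup (M : Type uM) [AddCommGroup M] (b : Bool) : AddSubgroup M := bif b then ⊤ else ⊥

/-- Used to project solutions found in `M` to `e_S M`. -/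
theorem vertex_smul_mem_wordAct {D : List (Letter V)} (hD : ∀ l, D.head? = some l → l.leftEnd = S)
    {b : Bool} {x : M} (hx : x ∈ wordAct K ρ D (endSubgroup M b)) :
    vertex K ρ S • x ∈ wordAct K ρ D (endSubgroup M b) := by
  match D, hD with
  | [], _ =>
    cases b
    · have h0 : x = 0 := hx
      rw [h0, smul_zero]
      exact zero_mem _
    · exact AddSubgroup.mem_top _
  | .direct a :: D, hD =>
    obtain rfl : a.right = S := hD _ rfl
    obtain ⟨y, hy, rfl⟩ := mem_wordAct_direct.1 hx
    rw [← mul_smul, vertex_mul_arrow]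
    exact hx
  | .inverse a :: D, hD =>
    obtain rfl : a.left = S := hD _ rfl
    rw [mem_wordAct_inverse, ← mul_smul, arrow_mul_vertex]
    exact hx

/-! ### The pp formulas of finite words -/

/-- The formula of a word `D` is given by a word that depends on `D` only. -/
theorem exists_formula_iff (hρ : IsStringPresentation ρ) (hside : IsSidePartition ρ side)
    {D : List (Letter V)} (hD : IsInH ρ side S i D) :
    ∃ (E : List (Letter V)) (b : Bool), IsInH ρ side S i E ∧ D <+: E ∧
      ((b = false ∧ ∃ c, E = D ++ [.inverse c]) ∨
        (b = true ∧ E = D ∧ ¬ ∃ c, IsInH ρ side S i (D ++ [.inverse c]))) ∧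
      ∀ x : M, Formula K ρ side S i D x ↔
        vertex K ρ S • x = x ∧ x ∈ wordAct K ρ E (endSubgroup M b) := by
  by_cases h : ∃ c, IsInH ρ side S i (D ++ [.inverse c])
  · obtain ⟨c, hc⟩ := h
    refine ⟨_, false, hc, List.prefix_append _ _, Or.inl ⟨rfl, c, rfl⟩, fun x => ?_⟩
    refine and_congr_right fun hx => ⟨?_, fun hm => Or.inl ⟨c, hc, hm⟩⟩
    rintro (⟨c', hc', hm⟩ | ⟨hn, _⟩)
    · rw [hc.letter_unique hρ hside hc' rfl]
      exact hm
    · exact absurd ⟨c, hc⟩ hn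
  · refine ⟨D, true, hD, List.prefix_rfl, Or.inr ⟨rfl, rfl, h⟩, fun x => ?_⟩
    refine and_congr_right fun hx => ⟨?_, fun hm => Or.inr ⟨h, hm⟩⟩
    rintro (⟨c', hc', hm⟩ | ⟨_, hm⟩)
    · exact absurd ⟨c', hc'⟩ h
    · exact hm

theorem Formula.add (hρ : IsStringPresentation ρ) (hside : IsSidePartition ρ side)
    {D : List (Letter V)} (hD : IsInH ρ side S i D) {x y : M} (hx : Formula K ρ side S i D x)
    (hy : Formula K ρ side S i D y) : Formula K ρ side S i D (x + y) := by
  obtain ⟨E, b, -, -, -, h⟩ := exists_formula_iff (K := K) (M := M) hρ hside hD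
  rw [h] at *
  exact ⟨by rw [smul_add, hx.1, hy.1], add_mem hx.2 hy.2⟩

theorem Formula.neg (hρ : IsStringPresentation ρ) (hside : IsSidePartition ρ side)
    {D : List (Letter V)} (hD : IsInH ρ side S i D) {x : M} (hx : Formula K ρ side S i D x) :
    Formula K ρ side S i D (-x) := by
  obtain ⟨E, b, -, -, -, h⟩ := exists_formula_iff (K := K) (M := M) hρ hside hD
  rw [h] at *
  exact ⟨by rw [smul_neg, hx.1], neg_mem hx.2⟩

theorem Formula.sub (hρ : IsStringPresentation ρ) (hside : IsSidePartition ρ side)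
    {D : List (Letter V)} (hD : IsInH ρ side S i D) {x y : M} (hx : Formula K ρ side S i D x)
    (hy : Formula K ρ side S i D y) : Formula K ρ side S i D (x - y) :=
  sub_eq_add_neg x y ▸ hx.add hρ hside hD (hy.neg hρ hside hD)

theorem Formula.mem_top {D C : List (Letter V)} {x : M} (hx : Formula K ρ side S i D x)
    (h : C <+: D) : x ∈ wordAct K ρ C ⊤ := by
  obtain ⟨t, rfl⟩ := h
  rcases hx.2 with ⟨c, _, hm⟩ | ⟨_, hm⟩
  · rw [List.append_assoc, wordAct_append] at hm
    exact wordAct_mono _ le_top hm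
  · rw [wordAct_append] at hm
    exact wordAct_mono _ le_top hm

theorem formula_of_mem_bot {D C : List (Letter V)} {x : M} (hS : vertex K ρ S • x = x)
    (hx : x ∈ wordAct K ρ C ⊥) (h : C <+: D) : Formula K ρ side S i D x := by
  obtain ⟨t, rfl⟩ := h
  refine ⟨hS, ?_⟩
  by_cases h : ∃ c, IsInH ρ side S i (C ++ t ++ [.inverse c])
  · obtain ⟨c, hc⟩ := h
    refine Or.inl ⟨c, hc, ?_⟩
    rw [List.append_assoc, wordAct_append]
    exact wordAct_mono _ bot_le hx
  · refine Or.inr ⟨h, ?_⟩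
    rw [wordAct_append]
    exact wordAct_mono _ bot_le hx

/-- The formula of a word implies the formulas of its initial subwords that are followed by a
direct letter. -/
theorem Formula.of_direct (hρ : IsStringPresentation ρ) (hside : IsSidePartition ρ side)
    {C E : List (Letter V)} {a : Quiver.Total V} (hE : IsInH ρ side S i E)
    (h : C ++ [.direct a] <+: E) {x : M} (hx : Formula K ρ side S i E x) :
    Formula K ρ side S i C x := by
  refine ⟨hx.1, ?_⟩
  have hm := hx.mem_top h
  rw [wordAct_append] at hm
  by_cases hc : ∃ c, IsInH ρ side S i (C ++ [.inverse c])
  · obtain ⟨c, hc⟩ := hc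
    refine Or.inl ⟨c, hc, ?_⟩
    have hrel := (hE.prefix h).rel_of_concat hρ hside hc
    rw [wordAct_append]
    refine wordAct_mono _ ?_ hm
    rintro y ⟨z, -, rfl⟩
    change arrow K ρ c • arrow K ρ a • z = 0
    have := prod_arrow_eq_zero (K := K) hrel
    simp only [List.map_cons, List.map_nil, List.prod_cons, List.prod_nil, mul_one] at this
    rw [← mul_smul, this, zero_smul]
  · exact Or.inr ⟨hc, wordAct_mono _ le_top hm⟩

/-- The formula of a word implies the formulas of its extensions beginning with an inverse
letter. -/
theorem Formula.of_inverse (hρ : IsStringPresentation ρ) (hside : IsSidePartition ρ side)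
    {C D : List (Letter V)} {c : Quiver.Total V} (hD : IsInH ρ side S i D)
    (h : C ++ [.inverse c] <+: D) {x : M} (hx : Formula K ρ side S i C x) :
    Formula K ρ side S i D x := by
  refine formula_of_mem_bot hx.1 ?_ h
  rcases hx.2 with ⟨c', hc', hm⟩ | ⟨hn, _⟩
  · rwa [(hD.prefix h).letter_unique hρ hside hc' rfl]
  · exact absurd ⟨c, hD.prefix h⟩ hn

theorem take_concat_prefix {α : Type*} {D : List α} {n : ℕ} {l : α} (h : D[n]? = some l) :
    D.take n ++ [l] <+: D := by
  obtain ⟨hn, rfl⟩ := List.getElem?_eq_some_iff.1 h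
  rw [List.take_append_getElem hn]
  exact List.take_prefix _ _

/-- Let C be the common initial part. Then E is C or continues it by a direct letter, and D is C or
continues it by an inverse letter. So the formula of E implies that of C, which implies that of D.
-/
theorem Formula.mono_of_lt (hρ : IsStringPresentation ρ) (hside : IsSidePartition ρ side)
    {D E : List (Letter V)} (hD : IsInH ρ side S i D) (hE : IsInH ρ side S i E)
    (hDE : HHat.ofList D hD < HHat.ofList E hE) {x : M} (hx : Formula K ρ side S i E x) :
    Formula K ρ side S i D x := by
  obtain ⟨n, hn, hn'⟩ := hDE
  simp only [HHat.get?_ofList] at hn hn'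
  have htake : D.take n = E.take n := by
    apply List.ext_getElem?
    intro k
    rw [List.getElem?_take, List.getElem?_take]
    split_ifs with hk
    · exact hn k hk
    · rfl
  have h1 : Formula K ρ side S i (E.take n) x := by
    by_cases hp : 0 < letterRank (E[n]?)
    · obtain ⟨a, ha⟩ := letterRank_eq_one hp
      exact hx.of_direct hρ hside hE (take_concat_prefix ha)
    · have h0 : letterRank (E[n]?) = 0 := by
        have := neg_one_le_letterRank (D[n]?)
        omega
      have := List.getElem?_eq_none_iff.1 (letterRank_eq_zero h0)
      rwa [List.take_of_length_le this]
  rw [← htake] at h1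
  by_cases hp : letterRank (D[n]?) < 0
  · obtain ⟨c, hc⟩ := letterRank_eq_neg_one hp
    exact h1.of_inverse hρ hside hD (take_concat_prefix hc)
  · have h0 : letterRank (D[n]?) = 0 := by
      have := letterRank_le_one (E[n]?)
      omega
    have := List.getElem?_eq_none_iff.1 (letterRank_eq_zero h0)
    rwa [List.take_of_length_le this] at h1

theorem Formula.mono (hρ : IsStringPresentation ρ) (hside : IsSidePartition ρ side)
    {D E : List (Letter V)} (hD : IsInH ρ side S i D) (hE : IsInH ρ side S i E)
    (hDE : HHat.ofList D hD ≤ HHat.ofList E hE) {x : M} (hx : Formula K ρ side S i E x) :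
    Formula K ρ side S i D x := by
  rcases hDE with h | h
  · exact hx.mono_of_lt hρ hside hD hE h
  · have := Stream'.Seq.ofList_injective (congrArg Subtype.val h)
    rwa [this]

/-! ### Strings of elements -/

/-- The supremum is over a nonempty set: a maximal word of inverse letters has a formula that every
element of `e_S M` satisfies, since preimages of the whole module are the whole module. -/
theorem exists_isStringOf (hρ : IsStringPresentation ρ) (hside : IsSidePartition ρ side) (i : ℤˣ)
    {m : M} (hm : vertex K ρ S • m = m) : ∃ s, IsStringOf K ρ side S i m s := by
  apply HHat.exists_isLUB hρ hside
  obtain ⟨q, hq, hq'⟩ := exists_maximal_inverse_extension hρ (isInH_nil hρ)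
  rw [List.nil_append] at hq hq'
  refine ⟨HHat.ofList _ hq, _, rfl, hm, Or.inr ⟨hq', ?_⟩⟩
  rw [wordAct_map_inverse_top]
  exact AddSubgroup.mem_top _

theorem IsStringOf.le {m : M} {s : HHat ρ side S i} (hs : IsStringOf K ρ side S i m s) {D : List (Letter V)}
    (hD : IsInH ρ side S i D) (h : Formula K ρ side S i D m) : HHat.ofList D hD ≤ s :=
  hs.1 ⟨D, rfl, h⟩

theorem IsStringOf.exists_gt (hρ : IsStringPresentation ρ) (hside : IsSidePartition ρ side)
    {m : M} {s t : HHat ρ side S i} (hs : IsStringOf K ρ side S i m s) (h : t < s) :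
    ∃ (D : List (Letter V)) (hD : IsInH ρ side S i D),
      t < HHat.ofList D hD ∧ Formula K ρ side S i D m := by
  let := HHat.linearOrder hρ hside S i
  by_contra! hcon
  refine absurd (hs.2 fun t' ht' => ?_) (not_le.2 h)
  obtain ⟨D, hD, hF⟩ := ht'
  have hH := t'.isInH_of_eq_ofList hD
  obtain rfl : t' = HHat.ofList D hH := Subtype.ext hD
  exact not_lt.1 fun h => hcon D hH h hF

theorem IsStringOf.formula (hρ : IsStringPresentation ρ) (hside : IsSidePartition ρ side)
    {m : M} {s : HHat ρ side S i} (hs : IsStringOf K ρ side S i m s) {D : List (Letter V)}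
    (hD : IsInH ρ side S i D) (h : HHat.ofList D hD < s) : Formula K ρ side S i D m := by
  obtain ⟨E, hE, hDE, hF⟩ := hs.exists_gt hρ hside h
  exact hF.mono_of_lt hρ hside hD hE hDE

theorem IsStringOf.unique (hρ : IsStringPresentation ρ) (hside : IsSidePartition ρ side)
    {m : M} {s t : HHat ρ side S i} (hs : IsStringOf K ρ side S i m s)
    (ht : IsStringOf K ρ side S i m t) : s = t := by
  let := HHat.linearOrder hρ hside S i
  exact IsLUB.unique hs ht

theorem exists_vertex_smul_ne_zero [Nontrivial M] : ∃ (S : V) (m : M), m ≠ 0 ∧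
    vertex K ρ S • m = m := by
  obtain ⟨m, hm⟩ := exists_ne (0 : M)
  by_contra! hcon
  apply hm
  rw [← one_smul (BoundQuiverAlgebra K ρ) m, ← sum_vertex, Finset.sum_smul]
  refine Finset.sum_eq_zero fun S _ => ?_
  by_contra hne
  exact hcon S _ hne (by rw [← mul_smul, vertex_mul_self])

end Action

end StringAlg

namespace StringAlg

/-! ### Algebraic compactness of pure injective modules -/

section Compactness

/-- A family of cosets of subspaces of a finite dimensional space that has the finite intersection
property has a common point. -/
theorem exists_forall_sub_mem_of_finite {K N J : Type*} [Field K] [AddCommGroup N] [Module K N]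
    [FiniteDimensional K N] (W : J → Submodule K N) (c : J → N)
    (h : ∀ F : Finset J, ∃ x, ∀ j ∈ F, x - c j ∈ W j) : ∃ x, ∀ j, x - c j ∈ W j := by
  classical
  -- A solution for a finite `F` with minimal intersection solves everything: a solution for `F` and
  -- `j` together differs from it by an element of that intersection, which by minimality lies in `W
  -- j`.
  obtain ⟨W₀, ⟨F, rfl⟩, hmin⟩ := IsArtinian.set_has_minimal
    (Set.range fun F : Finset J => ⨅ j ∈ F, W j) (Set.range_nonempty _)
  obtain ⟨x, hx⟩ := h F
  refine ⟨x, fun j => ?_⟩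
  obtain ⟨y, hy⟩ := h (insert j F)
  have hle : ⨅ k ∈ insert j F, W k ≤ ⨅ k ∈ F, W k :=
    biInf_mono fun k hk => Finset.mem_insert_of_mem hk
  have heq : ⨅ k ∈ insert j F, W k = ⨅ k ∈ F, W k :=
    hle.eq_or_lt.resolve_right (hmin _ ⟨_, rfl⟩)
  have hyx : y - x ∈ ⨅ k ∈ F, W k := by
    simp only [Submodule.mem_iInf]
    intro k hk
    have := sub_mem (hy k (Finset.mem_insert_of_mem hk)) (hx k hk)
    rwa [sub_sub_sub_cancel_right] at this
  rw [← heq] at hyx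
  simp only [Submodule.mem_iInf] at hyx
  have := sub_mem (hy j (Finset.mem_insert_self _ _)) (hyx j (Finset.mem_insert_self _ _))
  rwa [show y - c j - (y - x) = x - c j by abel] at this

variable {K : Type uK} [Field K] {V : Type uV} [Quiver.{uE} V] [Fintype V]
  {ρ : Set (List (Quiver.Total V))}

theorem map_mem_wordAct {M N : Type*} [AddCommGroup M] [Module (BoundQuiverAlgebra K ρ) M]
    [AddCommGroup N] [Module (BoundQuiverAlgebra K ρ) N] (f : M →ₗ[BoundQuiverAlgebra K ρ] N)
    (D : List (Letter V)) (b : Bool) {x : M} (hx : x ∈ wordAct K ρ D (endSubgroup M b)) :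
    f x ∈ wordAct K ρ D (endSubgroup N b) := by
  induction D generalizing x with
  | nil =>
    cases b
    · have h0 : x = 0 := hx
      rw [h0, map_zero]
      exact zero_mem _
    · exact AddSubgroup.mem_top _
  | cons l D ih =>
    cases l with
    | direct a =>
      obtain ⟨y, hy, rfl⟩ := mem_wordAct_direct.1 hx
      exact mem_wordAct_direct.2 ⟨f y, ih hy, (f.map_smul _ _).symm⟩
    | inverse a =>
      rw [mem_wordAct_inverse] at hx ⊢
      rw [← f.map_smul]
      exact ih hx

theorem pi_mem_wordAct {ι : Type*} {N : ι → Type*} [∀ j, AddCommGroup (N j)]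
    [∀ j, Module (BoundQuiverAlgebra K ρ) (N j)] (D : List (Letter V)) (b : Bool) {x : ∀ j, N j}
    (hx : ∀ j, x j ∈ wordAct K ρ D (endSubgroup (N j) b)) :
    x ∈ wordAct K ρ D (endSubgroup (∀ j, N j) b) := by
  induction D generalizing x with
  | nil =>
    cases b
    · exact funext hx
    · exact AddSubgroup.mem_top _
  | cons l D ih =>
    cases l with
    | direct a =>
      choose y hy hyx using fun j => mem_wordAct_direct.1 (hx j)
      exact mem_wordAct_direct.2 ⟨y, ih hy, funext hyx⟩
    | inverse a => exact mem_wordAct_inverse.2 (ih fun j => mem_wordAct_inverse.1 (hx j))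

/-- Multiplication by a scalar is a module endomorphism, and words are functorial. Hence the
subgroups are subspaces, to which the descending chain condition applies. -/
theorem smul_mem_wordAct {N : Type*} [AddCommGroup N] [Module K N]
    [Module (BoundQuiverAlgebra K ρ) N] [IsScalarTower K (BoundQuiverAlgebra K ρ) N]
    (D : List (Letter V)) (b : Bool) (k : K) {x : N}
    (hx : x ∈ wordAct K ρ D (endSubgroup N b)) : k • x ∈ wordAct K ρ D (endSubgroup N b) := by
  exact map_mem_wordAct (Module.toModuleEnd (BoundQuiverAlgebra K ρ) N k) D b hx

/-- Pure injective modules are algebraically compact with respect to the subgroups given by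
words. -/
theorem IsPureInjective.exists_forall_sub_mem {M : Type uM} [AddCommGroup M]
    [Module (BoundQuiverAlgebra K ρ) M]
    (hM : IsPureInjective.{uK, max uK uV uE, uM, uI, uN} K (BoundQuiverAlgebra K ρ) M)
    {J : Type*} (D : J → List (Letter V)) (b : J → Bool) (c : J → M)
    (h : ∀ F : Finset J, ∃ x, ∀ j ∈ F, x - c j ∈ wordAct K ρ (D j) (endSubgroup M (b j))) :
    ∃ x, ∀ j, x - c j ∈ wordAct K ρ (D j) (endSubgroup M (b j)) := by
  obtain ⟨ι, N, f, g, hfg⟩ := hM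
  let W : ∀ k : ι, J → Submodule K (N k).carrier := fun k j =>
    { wordAct K ρ (D j) (endSubgroup (N k).carrier (b j)) with
      smul_mem' := fun r _ hx => smul_mem_wordAct (D j) (b j) r hx }
  have hk : ∀ k, ∃ x, ∀ j, x - f (c j) k ∈ W k j := by
    refine fun k => exists_forall_sub_mem_of_finite (W k) _ fun F => ?_
    obtain ⟨x, hx⟩ := h F
    refine ⟨f x k, fun j hj => ?_⟩
    have := map_mem_wordAct ((LinearMap.proj k).comp f) (D j) (b j) (hx j hj)
    rw [map_sub] at this
    exact this
  choose x hx using hk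
  refine ⟨g x, fun j => ?_⟩
  have h1 : x - f (c j) ∈ wordAct K ρ (D j) (endSubgroup _ (b j)) :=
    pi_mem_wordAct (D j) (b j) fun k => hx k j
  have h2 := map_mem_wordAct g (D j) (b j) h1
  rwa [map_sub, show g (f (c j)) = c j from LinearMap.congr_fun hfg (c j)] at h2

/-- Compactness for a coset of a subgroup given by a word and the formulas of a set of words in
`H_i(S)`: it suffices to solve for one formula at a time. -/
theorem IsPureInjective.exists_forall_formula (hρ : IsStringPresentation ρ)
    {side : Letter V → ℤˣ} (hside : IsSidePartition ρ side) {S : V} {i : ℤˣ}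
    {M : Type uM} [AddCommGroup M] [Module (BoundQuiverAlgebra K ρ) M]
    (hM : IsPureInjective.{uK, max uK uV uE, uM, uI, uN} K (BoundQuiverAlgebra K ρ) M)
    {E : List (Letter V)} (hE : ∀ l, E.head? = some l → l.leftEnd = S) (b : Bool) {m : M}
    (hm : vertex K ρ S • m = m) (T : Set (List (Letter V))) (hT : ∀ D ∈ T, IsInH ρ side S i D)
    (h : ∀ D ∈ T, ∃ x, x - m ∈ wordAct K ρ E (endSubgroup M b) ∧ Formula K ρ side S i D x) :
    ∃ x, vertex K ρ S • x = x ∧ x - m ∈ wordAct K ρ E (endSubgroup M b) ∧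
      ∀ D ∈ T, Formula K ρ side S i D x := by
  classical
  let := HHat.linearOrder hρ hside S i
  choose W c hW _ _ hF using fun D : T =>
    exists_formula_iff (K := K) (M := M) hρ hside (hT D.1 D.2)
  -- The index `none` carries the coset condition, the indices in `T` the formulas, without the
  -- requirement of lying in `e_S M`.
  obtain ⟨x, hx⟩ := hM.exists_forall_sub_mem (J := Option T) (fun j => j.elim E W)
    (fun j => j.elim b c) (fun j => j.elim m fun _ => 0) (by
      intro F
      have key : ∃ x, x - m ∈ wordAct K ρ E (endSubgroup M b) ∧
          ∀ D ∈ Finset.eraseNone F, Formula K ρ side S i D.1 x := by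
        rcases (Finset.eraseNone F).eq_empty_or_nonempty with h0 | h0
        · exact ⟨m, by rw [sub_self]; exact zero_mem _, by simp [h0]⟩
        -- The formula of the largest of finitely many words implies all the others.
        · obtain ⟨D, hD, hmax⟩ := Finset.exists_max_image _
            (fun D : T => HHat.ofList D.1 (hT D.1 D.2)) h0
          obtain ⟨x, hx, hxD⟩ := h D.1 D.2
          exact ⟨x, hx, fun D' hD' => hxD.mono hρ hside _ _ (hmax D' hD')⟩
      obtain ⟨x, hx, hxF⟩ := key
      refine ⟨x, ?_⟩
      rintro (_ | D) hj
      · exact hx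
      · have := (hF D x).1 (hxF D (Finset.mem_eraseNone.2 hj))
        simpa using this.2)
  -- Multiplying by `e_S` preserves all conditions, since the words start at `S` and `m` is fixed.
  have he : vertex K ρ S • vertex K ρ S • x = vertex K ρ S • x := by
    rw [← mul_smul, vertex_mul_self]
  refine ⟨vertex K ρ S • x, he, ?_, fun D hD => ?_⟩
  · have := vertex_smul_mem_wordAct hE (hx none)
    rwa [smul_sub, show vertex K ρ S • (none : Option T).elim m (fun _ => 0) = m from hm] at this
  · rw [hF ⟨D, hD⟩]
    refine ⟨he, vertex_smul_mem_wordAct (fun l hl => ((hW ⟨D, hD⟩).2 l hl).1) ?_⟩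
    simpa using hx (some ⟨D, hD⟩)

end Compactness

end StringAlg

namespace StringAlg

/-! ### Immediate successors among finite words -/

section Successor

variable {V : Type uV} [Quiver.{uE} V] {ρ : Set (List (Quiver.Total V))}
  {side : Letter V → ℤˣ} {S : V} {i : ℤˣ}

theorem eq_map_direct_or (D : List (Letter V)) : (∃ p : List (Quiver.Total V), D = p.map .direct) ∨
    ∃ (C : List (Letter V)) (c : Quiver.Total V) (p : List (Quiver.Total V)),
      D = C ++ .inverse c :: p.map .direct := by
  induction D with
  | nil => exact Or.inl ⟨[], rfl⟩
  | cons l D ih =>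
    rcases ih with ⟨p, rfl⟩ | ⟨C, c, p, rfl⟩
    · cases l with
      | direct a => exact Or.inl ⟨a :: p, rfl⟩
      | inverse c => exact Or.inr ⟨[], c, p, rfl⟩
    · exact Or.inr ⟨l :: C, c, p, rfl⟩

theorem letterRank_getElem?_map_direct_nonneg (p : List (Quiver.Total V)) (n : ℕ) :
    0 ≤ letterRank ((p.map Letter.direct)[n]?) := by
  rw [List.getElem?_map]
  cases p[n]? <;> simp [letterRank]

theorem letterRank_getElem?_map_inverse_nonpos (p : List (Quiver.Total V)) (n : ℕ) :
    letterRank ((p.map Letter.inverse)[n]?) ≤ 0 := by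
  rw [List.getElem?_map]
  cases p[n]? <;> simp [letterRank]

theorem concat_prefix_of_agree {α : Type*} {D E : List α} (h : ∀ k < D.length, D[k]? = E[k]?)
    {l : α} (hl : E[D.length]? = some l) : D ++ [l] <+: E := by
  have := take_concat_prefix hl
  rwa [show E.take D.length = D by
    apply List.ext_getElem?
    intro k
    rw [List.getElem?_take]
    split_ifs with hk
    · exact (h k hk).symm
    · rw [List.getElem?_eq_none (by omega)]] at this

/-- A finite word that is not extendable by a direct letter and differs from a larger word
differs from it at an inverse letter. -/
theorem exists_inverse_of_lt {D E : List (Letter V)} {hD : IsInH ρ side S i D}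
    {hE : IsInH ρ side S i E} (hmax : ¬ ∃ a, IsInH ρ side S i (D ++ [.direct a]))
    (h : HHat.ofList D hD < HHat.ofList E hE) : ∃ n < D.length, (∀ k < n, D[k]? = E[k]?) ∧
      letterRank (D[n]?) < 0 ∧ letterRank (D[n]?) < letterRank (E[n]?) := by
  obtain ⟨n, hn, hn'⟩ := h
  simp only [HHat.get?_ofList] at hn hn'
  rcases lt_trichotomy n D.length with h | rfl | h
  · refine ⟨n, h, hn, ?_, hn'⟩
    have h1 := letterRank_le_one (E[n]?)
    rw [List.getElem?_eq_getElem h] at hn' ⊢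
    cases h2 : D[n] with
    | direct a =>
      rw [h2] at hn'
      rw [show letterRank (some (Letter.direct a)) = 1 from rfl] at hn'
      omega
    | inverse c => simp [letterRank]
  · rw [List.getElem?_eq_none le_rfl] at hn'
    obtain ⟨a, ha⟩ := letterRank_eq_one hn'
    exact absurd ⟨a, hE.prefix (concat_prefix_of_agree hn ha)⟩ hmax
  · have h1 := hn _ h
    rw [List.getElem?_eq_none le_rfl, eq_comm, List.getElem?_eq_none_iff] at h1
    rw [List.getElem?_eq_none h.le, List.getElem?_eq_none (by omega)] at hn'
    exact absurd hn' (lt_irrefl _)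

/-- Every finite word that is not the largest element of `H_i(S)` has an immediate successor. -/
theorem exists_successor (hρ : IsStringPresentation ρ) (hside : IsSidePartition ρ side)
    {D : List (Letter V)} (hD : IsInH ρ side S i D) :
    (∃ (E : List (Letter V)) (hE : IsInH ρ side S i E), HHat.ofList D hD < HHat.ofList E hE ∧
      ∀ (E' : List (Letter V)) (hE' : IsInH ρ side S i E'),
        HHat.ofList D hD < HHat.ofList E' hE' → HHat.ofList E hE ≤ HHat.ofList E' hE') ∨
    ∀ (E' : List (Letter V)) (hE' : IsInH ρ side S i E'),
      ¬ HHat.ofList D hD < HHat.ofList E' hE' := by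
  let := HHat.linearOrder hρ hside S i
  by_cases hext : ∃ a, IsInH ρ side S i (D ++ [.direct a])
  · obtain ⟨a, ha⟩ := hext
    -- The smallest word above `D` is obtained by adding the direct letter and then as many inverse
    -- letters as possible.
    obtain ⟨q, hq, hq'⟩ := exists_maximal_inverse_extension hρ ha
    have hDq : ∀ k < D.length, (D ++ [.direct a] ++ q.map .inverse)[k]? = D[k]? := by
      intro k hk
      rw [List.append_assoc, List.getElem?_append_left hk]
    have hDa : (D ++ [Letter.direct a] ++ q.map .inverse)[D.length]? = some (.direct a) := by
      simp
    refine Or.inl ⟨_, hq, ⟨D.length, fun k hk => ?_, ?_⟩, fun E' hE' hlt => ?_⟩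
    · simp only [HHat.get?_ofList, hDq k hk]
    · simp only [HHat.get?_ofList, hDa, List.getElem?_eq_none le_rfl]
      simp [letterRank]
    · by_contra hnle
      obtain ⟨m, hm, hm'⟩ := not_le.1 hnle
      obtain ⟨n, hn, hn'⟩ := hlt
      simp only [HHat.get?_ofList] at hm hm' hn hn'
      rcases lt_trichotomy n D.length with h | rfl | h
      · rcases lt_trichotomy m n with h' | rfl | h'
        · rw [hDq m (by omega), hn m h'] at hm'
          exact lt_irrefl _ hm'
        · rw [hDq m h] at hm'
          omega
        · rw [hm n h', hDq n h] at hn'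
          exact lt_irrefl _ hn'
      · rw [List.getElem?_eq_none le_rfl] at hn'
        rcases lt_trichotomy m D.length with h' | rfl | h'
        · rw [hDq m h', hn m h'] at hm'
          exact lt_irrefl _ hm'
        · rw [hDa] at hm'
          simp only [letterRank] at hn' hm'
          omega
        · have h1 : (D ++ [Letter.direct a] ++ q.map .inverse)[m]? =
              (q.map Letter.inverse)[m - (D.length + 1)]? := by
            rw [List.getElem?_append_right (by simp; omega)]
            simp
          have h2 := letterRank_getElem?_map_inverse_nonpos q (m - (D.length + 1))
          have h3 := neg_one_le_letterRank (E'[m]?)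
          have h4 : letterRank ((D ++ [Letter.direct a] ++ q.map .inverse)[m]?) = 0 := by
            rw [h1] at hm' ⊢; omega
          have h5 := List.getElem?_eq_none_iff.1 (letterRank_eq_zero h4)
          rw [h4] at hm'
          obtain ⟨c, hc⟩ := letterRank_eq_neg_one hm'
          have h6 : m = (D ++ [Letter.direct a] ++ q.map Letter.inverse).length := by
            by_contra hne
            have h7 := hm (D ++ [Letter.direct a] ++ q.map Letter.inverse).length (by omega)
            rw [List.getElem?_eq_none le_rfl, List.getElem?_eq_none_iff] at h7
            rw [List.getElem?_eq_none (by omega)] at hc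
            cases hc
          exact hq' ⟨c, hE'.prefix (concat_prefix_of_agree
            (fun k hk => (hm k (by omega)).symm) (h6 ▸ hc))⟩
      · have h1 := hn _ h
        rw [List.getElem?_eq_none le_rfl, eq_comm, List.getElem?_eq_none_iff] at h1
        rw [List.getElem?_eq_none h.le, List.getElem?_eq_none (by omega)] at hn'
        exact absurd hn' (lt_irrefl _)
  · rcases eq_map_direct_or D with ⟨p, rfl⟩ | ⟨C, c, p, rfl⟩
    · refine Or.inr fun E' hE' hlt => ?_
      obtain ⟨n, -, -, hn, -⟩ := exists_inverse_of_lt hext hlt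
      exact absurd hn (not_lt.2 (letterRank_getElem?_map_direct_nonneg p n))
    -- If no direct letter can be added, a larger word must leave `D` at an inverse letter. The
    -- latest possibility is the last inverse letter `c`, so the successor is the part `C` before
    -- it.
    · have hC : IsInH ρ side S i C := hD.prefix (List.prefix_append _ _)
      have hCD : ∀ k < C.length, (C ++ Letter.inverse c :: p.map .direct)[k]? = C[k]? :=
        fun k hk => List.getElem?_append_left hk
      refine Or.inl ⟨C, hC, ⟨C.length, fun k hk => ?_, ?_⟩, fun E' hE' hlt => ?_⟩
      · simp only [HHat.get?_ofList, hCD k hk]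
      · simp [letterRank]
      · obtain ⟨n, hn, hn1, hn2, hn3⟩ := exists_inverse_of_lt hext hlt
        rcases lt_trichotomy n C.length with h | rfl | h
        · refine Or.inl ⟨n, fun k hk => ?_, ?_⟩
          · simp only [HHat.get?_ofList]
            rw [← hn1 k hk, hCD k (by omega)]
          · simp only [HHat.get?_ofList]
            rwa [← hCD n h]
        · have hag : ∀ k < C.length, C[k]? = E'[k]? := fun k hk => by
            rw [← hn1 k hk, hCD k hk]
          by_contra hnle
          obtain ⟨m, hm, hm'⟩ := not_le.1 hnle
          simp only [HHat.get?_ofList] at hm hm'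
          rcases lt_trichotomy m C.length with h' | rfl | h'
          · rw [hag m h'] at hm'
            exact lt_irrefl _ hm'
          · rw [List.getElem?_eq_none (l := C) le_rfl] at hm'
            simp [letterRank] at hm' hn3
            omega
          · have h1 := hm _ h'
            rw [List.getElem?_eq_none (l := C) le_rfl, List.getElem?_eq_none_iff] at h1
            rw [List.getElem?_eq_none (l := C) h'.le, List.getElem?_eq_none (by omega)] at hm'
            exact absurd hm' (lt_irrefl _)
        · exfalso
          obtain ⟨k, rfl⟩ : ∃ k, n = C.length + (k + 1) := ⟨n - C.length - 1, by omega⟩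
          rw [List.getElem?_append_right (by omega), Nat.add_sub_cancel_left,
            List.getElem?_cons_succ] at hn2
          exact absurd hn2 (not_lt.2 (letterRank_getElem?_map_direct_nonneg p k))

end Successor

/-! ### Elements with a finite string -/

section FiniteString

variable {K : Type uK} [Field K] {V : Type uV} [Quiver.{uE} V] [Fintype V]
  {ρ : Set (List (Quiver.Total V))} {side : Letter V → ℤˣ} {S : V} {i j : ℤˣ}
  {M : Type uM} [AddCommGroup M] [Module (BoundQuiverAlgebra K ρ) M]

/-- Homogeneity with respect to the strings on the sides `i` and `j`. -/
def IsHomogeneousOn (K : Type uK) [Field K] {V : Type uV} [Quiver.{uE} V] [Fintype V]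
    (ρ : Set (List (Quiver.Total V))) {M : Type uM} [AddCommGroup M]
    [Module (BoundQuiverAlgebra K ρ) M] (side : Letter V → ℤˣ) (S : V) (i j : ℤˣ) (m : M) : Prop :=
  m ≠ 0 ∧ vertex K ρ S • m = m ∧
    ∃ (u : HHat ρ side S i) (v : HHat ρ side S j),
      IsStringOf K ρ side S i m u ∧ IsStringOf K ρ side S j m v ∧
      ¬ ∃ x : M, vertex K ρ S • x = x ∧
        ∃ (u' : HHat ρ side S i) (v' : HHat ρ side S j),
          IsStringOf K ρ side S i x u' ∧ IsStringOf K ρ side S j (m - x) v' ∧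
          u < u' ∧ v < v'

/-- The substitution of `m - x` for `x` exchanges the two sides. -/
theorem IsHomogeneousOn.symm {m : M} (h : IsHomogeneousOn K ρ side S i j m) :
    IsHomogeneousOn K ρ side S j i m := by
  obtain ⟨h0, hm, u, v, hu, hv, hn⟩ := h
  refine ⟨h0, hm, v, u, hv, hu, ?_⟩
  rintro ⟨x, hx, v', u', hv', hu', hvv, huu⟩
  exact hn ⟨m - x, by rw [smul_sub, hm, hx], u', v', hu', by rwa [sub_sub_cancel], huu, hvv⟩

/-- A nonzero element one of whose strings is finite can be modified to a homogeneous element. -/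
theorem exists_isHomogeneousOn_of_finite (hρ : IsStringPresentation ρ)
    (hside : IsSidePartition ρ side)
    (hM : IsPureInjective.{uK, max uK uV uE, uM, uI, uN} K (BoundQuiverAlgebra K ρ) M)
    {m : M} (h0 : m ≠ 0) (hm : vertex K ρ S • m = m) {D : List (Letter V)}
    (hD : IsInH ρ side S i D) (hs : IsStringOf K ρ side S i m (HHat.ofList D hD)) (j : ℤˣ) :
    ∃ m' : M, IsHomogeneousOn K ρ side S i j m' := by
  let := HHat.linearOrder hρ hside S i
  let := HHat.linearOrder hρ hside S j
  rcases exists_successor hρ hside hD with ⟨E, hE, hDE, hsucc⟩ | hmax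
  · obtain ⟨W, b, hW, -, -, hF⟩ := exists_formula_iff (K := K) (M := M) hρ hside hE
    -- The set consists of all words in `H_j(S)` whose formula has a solution in the coset of `m`
    -- modulo the solutions of `E`. Thus `y` has the largest `j`-string possible in that coset.
    obtain ⟨y, hy, hym, hyT⟩ := hM.exists_forall_formula hρ hside (i := j)
      (fun l hl => (hW.2 l hl).1) b hm
      {C | IsInH ρ side S j C ∧ ∃ x, x - m ∈ wordAct K ρ W (endSubgroup M b) ∧
        Formula K ρ side S j C x} (fun C hC => hC.1) (fun C hC => hC.2)
    have hym' : Formula K ρ side S i E (y - m) := (hF _).2 ⟨by rw [smul_sub, hm, hy], hym⟩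
    have hEm : ¬ Formula K ρ side S i E m := fun h =>
      absurd (hs.le hE h) (not_le.2 hDE)
    -- Passing from `m` to `y` does not change the `i`-string: `y - m` satisfies every formula up to
    -- that of `E`, and a formula above `D` for `y` would give that of `E` for `m`.
    have hiff : ∀ C, IsInH ρ side S i C →
        (Formula K ρ side S i C m ↔ Formula K ρ side S i C y) := by
      intro C hC
      have hle : HHat.ofList C hC ≤ HHat.ofList D hD → Formula K ρ side S i C (y - m) :=
        fun h => hym'.mono_of_lt hρ hside hC hE (h.trans_lt hDE)
      constructor
      · intro h
        have := (hle (hs.le hC h)).add hρ hside hC h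
        rwa [sub_add_cancel] at this
      · intro h
        by_cases hCD : HHat.ofList C hC ≤ HHat.ofList D hD
        · have := h.sub hρ hside hC (hle hCD)
          rwa [sub_sub_cancel] at this
        · have h1 := h.mono hρ hside hE hC (hsucc C hC (not_le.1 hCD))
          have := h1.sub hρ hside hE hym'
          rw [sub_sub_cancel] at this
          exact absurd this hEm
    have hy0 : y ≠ 0 := by
      rintro rfl
      have := hym'.neg hρ hside hE
      rw [zero_sub, neg_neg] at this
      exact hEm this
    have hsy : IsStringOf K ρ side S i y (HHat.ofList D hD) := by
      have : {t : HHat ρ side S i | ∃ C, t.1 = Stream'.Seq.ofList C ∧ Formula K ρ side S i C m} =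
          {t | ∃ C, t.1 = Stream'.Seq.ofList C ∧ Formula K ρ side S i C y} := by
        ext t
        refine exists_congr fun C => and_congr_right fun ht => hiff C (t.isInH_of_eq_ofList ht)
      unfold IsStringOf at hs ⊢
      rwa [← this]
    obtain ⟨t, ht⟩ := exists_isStringOf hρ hside j hy
    refine ⟨y, hy0, hy, _, t, hsy, ht, ?_⟩
    rintro ⟨x, hx, u', v', hu', hv', huu, hvv⟩
    obtain ⟨C, hC, hDC, hCx⟩ := hu'.exists_gt hρ hside huu
    have hEx : Formula K ρ side S i E x := hCx.mono hρ hside hE hC (hsucc C hC hDC)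
    obtain ⟨B, hB, htB, hBx⟩ := hv'.exists_gt hρ hside hvv
    -- Both `y - m` and `x` satisfy the formula of `E`, so `y - x` is in the coset and its formulas
    -- are among those satisfied by `y`.
    refine absurd (ht.le hB (hyT B ⟨hB, y - x, ?_, hBx⟩)) (not_le.2 htB)
    have := ((hF _).1 (hym'.sub hρ hside hE hEx)).2
    rwa [show y - m - x = y - x - m by abel] at this
  · obtain ⟨t, ht⟩ := exists_isStringOf hρ hside j hm
    refine ⟨m, h0, hm, _, t, hs, ht, ?_⟩
    rintro ⟨x, hx, u', v', hu', hv', huu, hvv⟩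
    obtain ⟨C, hC, hDC, -⟩ := hu'.exists_gt hρ hside huu
    exact hmax C hC hDC

end FiniteString

end StringAlg

namespace StringAlg

/-! ### Adding and removing the first letter of a word -/

section FirstLetter

variable {V : Type uV} [Quiver.{uE} V] {ρ : Set (List (Quiver.Total V))}
  {side : Letter V → ℤˣ} {S : V} {i : ℤˣ}

/-- The letter `l.inv` starts at the same vertex as the rest of the word. If the next letter were on
its side, the word would cancel or contain a relation or its inverse, whence the sign. -/
theorem IsInH.tail (hρ : IsStringPresentation ρ) (hside : IsSidePartition ρ side) {l : Letter V}
    {E : List (Letter V)} (h : IsInH ρ side S i (l :: E)) :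
    IsInH ρ side l.rightEnd (-side l.inv) E := by
  refine ⟨h.1.infix (List.suffix_cons _ _).isInfix, fun l' hl' => ?_⟩
  obtain ⟨E, rfl⟩ := List.head?_eq_some_iff.1 hl'
  obtain ⟨h1, h2, h3⟩ := (isString_pair_iff hρ).1 (h.1.infix ⟨[], E, rfl⟩ : IsString ρ [l, l'])
  refine ⟨h1.symm, Int.units_ne_iff_eq_neg.1 fun heq => ?_⟩
  cases l with
  | direct a =>
    cases l' with
    | direct b => exact (h3 _ _ (hside.rel b a h1.symm heq)).1 ⟨rfl, rfl⟩
    | inverse c => exact h2 (by rw [hside.inverse c a h1.symm heq]; rfl)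
  | inverse a =>
    cases l' with
    | direct b => exact h2 (by rw [hside.direct b a h1.symm heq]; rfl)
    | inverse c => exact (h3 _ _ (hside.rel a c h1 heq.symm)).2 ⟨rfl, rfl⟩

/-- The choice of side already excludes cancellation, so adding `l` can only fail through a
relation, or the inverse of one, that begins at `l`. -/
theorem IsInH.cons_or {l : Letter V} {E : List (Letter V)} (hS : l.leftEnd = S) (hi : side l = i)
    (h : IsInH ρ side l.rightEnd (-side l.inv) E) : IsInH ρ side S i (l :: E) ∨
      ∃ r ∈ ρ, r.map .direct <+: l :: E ∨ r.reverse.map .inverse <+: l :: E := by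
  by_contra! hcon
  refine hcon.1 ⟨⟨?_, fun r hr => ?_⟩, fun l' hl' => ?_⟩
  · rw [List.isChain_cons]
    refine ⟨fun l' hl' => ?_, h.1.1⟩
    obtain ⟨h1, h2⟩ := h.2 l' hl'
    refine ⟨h1.symm, ?_⟩
    rintro rfl
    exact Int.units_ne_iff_eq_neg.2 h2 rfl
  · simp only [List.infix_cons_iff]
    exact ⟨fun hh => hh.elim (hcon.2 r hr).1 (h.1.2 r hr).1,
      fun hh => hh.elim (hcon.2 r hr).2 (h.1.2 r hr).2⟩
  · obtain rfl : l = l' := by simpa using hl'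
    exact ⟨hS, hi⟩

theorem exists_of_map_prefix_cons {f : Quiver.Total V → Letter V} {r : List (Quiver.Total V)}
    (hr : r ≠ []) {l : Letter V} {E : List (Letter V)} (h : r.map f <+: l :: E) :
    ∃ a, l = f a := by
  cases r with
  | nil => exact absurd rfl hr
  | cons a r =>
    rw [List.map_cons, List.cons_prefix_cons] at h
    exact ⟨a, h.1.symm⟩

theorem IsStringPresentation.ne_nil (hρ : IsStringPresentation ρ) {r : List (Quiver.Total V)}
    (hr : r ∈ ρ) : r ≠ [] := by
  rintro rfl
  simpa using hρ.two_le_length _ hr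

theorem HHat.take_eq_of_prefix (s : HHat ρ side S i) {W P : List (Letter V)} {n : ℕ}
    (hag : ∀ k < n, W[k]? = s.1.get? k) (hP : P <+: W) (hn : P.length ≤ n) :
    s.1.take P.length = P := by
  apply List.ext_getElem?
  intro k
  rw [Stream'.Seq.getElem?_take]
  split_ifs with hk
  · rw [← hag k (by omega)]
    obtain ⟨t, rfl⟩ := hP
    rw [List.getElem?_append_left hk]
  · rw [List.getElem?_eq_none (by omega)]

/-- A word less than a one-sided string does not begin with a relation. -/
theorem HHat.not_direct_prefix (s : HHat ρ side S i) {W : List (Letter V)} {n : ℕ}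
    (hag : ∀ k < n, W[k]? = s.1.get? k) (hlt : letterRank (W[n]?) < letterRank (s.1.get? n))
    {r : List (Quiver.Total V)} (hr : r ∈ ρ) : ¬ r.map .direct <+: W := by
  intro hP
  -- Either the relation lies inside the common part and hence in `s`, or `W` has a direct letter at
  -- `n`, where the rank cannot be exceeded.
  by_cases hn : (r.map Letter.direct).length ≤ n
  · have h1 := s.take_eq_of_prefix hag hP hn
    exact ((s.2 (r.map Letter.direct).length).1.2 r hr).1 (by rw [h1])
  · obtain ⟨t, rfl⟩ := hP
    rw [List.getElem?_append_left (by omega), List.getElem?_map] at hlt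
    rw [List.length_map] at hn
    rw [List.getElem?_eq_getElem (by omega : n < r.length)] at hlt
    have := letterRank_le_one (s.1.get? n)
    exact absurd hlt (not_lt.2 this)

/-- A word greater than a one-sided string does not begin with the inverse of a relation. -/
theorem HHat.not_inverse_prefix (s : HHat ρ side S i) {W : List (Letter V)} {n : ℕ}
    (hag : ∀ k < n, W[k]? = s.1.get? k) (hlt : letterRank (s.1.get? n) < letterRank (W[n]?))
    {r : List (Quiver.Total V)} (hr : r ∈ ρ) : ¬ r.reverse.map .inverse <+: W := by
  intro hP
  by_cases hn : (r.reverse.map Letter.inverse).length ≤ n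
  · have h1 := s.take_eq_of_prefix hag hP hn
    exact ((s.2 (r.reverse.map Letter.inverse).length).1.2 r hr).2 (by rw [h1])
  · obtain ⟨t, rfl⟩ := hP
    rw [List.getElem?_append_left (by omega), List.getElem?_map] at hlt
    rw [List.length_map] at hn
    rw [List.getElem?_eq_getElem (by omega : n < r.reverse.length)] at hlt
    have := neg_one_le_letterRank (s.1.get? n)
    exact absurd hlt (not_lt.2 this)

/-- Between two distinct infinite words there is a finite one. -/
theorem HHat.exists_between {s t : HHat ρ side S i} (hs : ∀ n, s.1.get? n ≠ none)
    (ht : ∀ n, t.1.get? n ≠ none) (h : s < t) : ∃ (E : List (Letter V))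
      (hE : IsInH ρ side S i E), s < HHat.ofList E hE ∧ HHat.ofList E hE < t := by
  obtain ⟨n, hn, hn'⟩ := h
  have h0 : (HHat.ofList _ (t.2 n)).1.get? n = none := by
    rw [HHat.get?_ofList, Stream'.Seq.getElem?_take, if_neg (lt_irrefl _)]
  have h1 : ∀ k < n, (HHat.ofList _ (t.2 n)).1.get? k = t.1.get? k := fun k hk => by
    rw [HHat.get?_ofList, Stream'.Seq.getElem?_take, if_pos hk]
  refine ⟨t.1.take n, t.2 n, ⟨n, fun k hk => (hn k hk).trans (h1 k hk).symm, ?_⟩, n, h1, ?_⟩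
  · rw [h0]
    by_contra hcon
    have h2 : letterRank (s.1.get? n) ≠ 0 := fun h => hs n (letterRank_eq_zero h)
    have := letterRank_le_one (t.1.get? n)
    have h3 : ¬ letterRank (s.1.get? n) < 0 := hcon
    omega
  · rw [h0]
    by_contra hcon
    have h2 : letterRank (t.1.get? n) ≠ 0 := fun h => ht n (letterRank_eq_zero h)
    have := neg_one_le_letterRank (s.1.get? n)
    have h3 : ¬ 0 < letterRank (t.1.get? n) := hcon
    omega

end FirstLetter

/-! ### Realizing the tail of an infinite string -/

section Strip

variable {K : Type uK} [Field K] {V : Type uV} [Quiver.{uE} V] [Fintype V]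
  {ρ : Set (List (Quiver.Total V))} {side : Letter V → ℤˣ} {S : V} {i : ℤˣ}
  {M : Type uM} [AddCommGroup M] [Module (BoundQuiverAlgebra K ρ) M]

theorem mem_wordAct_of_inverse_prefix {r : List (Quiver.Total V)} (hr : r ∈ ρ)
    {W : List (Letter V)} (h : r.reverse.map .inverse <+: W) (N : AddSubgroup M) (x : M) :
    x ∈ wordAct K ρ W N := by
  obtain ⟨t, rfl⟩ := h
  rw [wordAct_append, mem_wordAct_map_inverse, prod_arrow_eq_zero hr, zero_smul]
  exact zero_mem _

theorem eq_zero_of_direct_prefix {r : List (Quiver.Total V)} (hr : r ∈ ρ)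
    {W : List (Letter V)} (h : r.map .direct <+: W) {N : AddSubgroup M} {x : M}
    (hx : x ∈ wordAct K ρ W N) : x = 0 := by
  obtain ⟨t, rfl⟩ := h
  rw [wordAct_append, mem_wordAct_map_direct] at hx
  obtain ⟨y, -, rfl⟩ := hx
  rw [prod_arrow_eq_zero hr, zero_smul]

theorem Formula.exists_of_direct_cons (hρ : IsStringPresentation ρ)
    (hside : IsSidePartition ρ side) {a : Quiver.Total V} {E : List (Letter V)}
    (h : IsInH ρ side S i (.direct a :: E)) {m : M}
    (hm : Formula K ρ side S i (.direct a :: E) m) : ∃ x, arrow K ρ a • x = m ∧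
      Formula K ρ side a.left (-side (.inverse a)) E x := by
  have hE := h.tail hρ hside
  obtain ⟨hS, hi⟩ := h.2 _ rfl
  obtain ⟨W, b, hW, hEW, hWb, hF⟩ := exists_formula_iff (K := K) (M := M) hρ hside hE
  have hmem : m ∈ wordAct K ρ (.direct a :: W) (endSubgroup M b) := by
    rcases hWb with ⟨rfl, c, rfl⟩ | ⟨rfl, rfl, hn⟩
    · rcases hW.cons_or (l := .direct a) hS hi with hH | ⟨r, hr, hr' | hr'⟩
      · rcases hm.2 with ⟨c', hc', hmem⟩ | ⟨hn, -⟩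
        · rw [IsInH.letter_unique hρ hside (C := .direct a :: E) hH hc' rfl]
          exact hmem
        · exact absurd ⟨c, hH⟩ hn
      -- A relation consists of direct letters, so it cannot reach the final inverse letter and
      -- would already occur in the string `a E`.
      · rw [← List.cons_append, List.prefix_concat_iff] at hr'
        rcases hr' with hr' | hr'
        · have : Letter.inverse c ∈ r.map Letter.direct := by rw [hr']; simp
          simp at this
        · exact absurd hr'.isInfix (h.1.2 r hr).1
      · obtain ⟨b, hb⟩ := exists_of_map_prefix_cons
          (List.reverse_eq_nil_iff.not.2 (hρ.ne_nil hr)) hr'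
        cases hb
    · exact hm.mem_top List.prefix_rfl
  obtain ⟨x, hx, rfl⟩ := mem_wordAct_direct.1 hmem
  refine ⟨vertex K ρ a.left • x, by rw [← mul_smul, arrow_mul_vertex], (hF _).2 ⟨?_, ?_⟩⟩
  · change vertex K ρ a.left • vertex K ρ a.left • x = _
    rw [← mul_smul, vertex_mul_self]
  · exact vertex_smul_mem_wordAct (fun l hl => (hW.2 l hl).1) hx

theorem Formula.direct_cons (hρ : IsStringPresentation ρ) (hside : IsSidePartition ρ side)
    {a : Quiver.Total V} {E : List (Letter V)} (h : IsInH ρ side S i (.direct a :: E)) {x : M}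
    (hx : Formula K ρ side a.left (-side (.inverse a)) E x) :
    Formula K ρ side S i (.direct a :: E) (arrow K ρ a • x) := by
  obtain ⟨rfl, hi⟩ := h.2 _ rfl
  obtain ⟨W, b, hW, -, hWb, hF⟩ := exists_formula_iff (K := K) (M := M) hρ hside h
  refine (hF _).2 ⟨?_, ?_⟩
  · change vertex K ρ a.right • _ = _
    rw [← mul_smul, vertex_mul_arrow]
  · rcases hWb with ⟨rfl, c, rfl⟩ | ⟨rfl, rfl, hn⟩
    · have hc := IsInH.tail (E := E ++ [.inverse c]) hρ hside hW
      rcases hx.2 with ⟨c', hc', hmem⟩ | ⟨hn, -⟩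
      · refine mem_wordAct_direct.2 ⟨x, ?_, rfl⟩
        change x ∈ wordAct K ρ (E ++ [.inverse c]) _
        rw [hc.letter_unique hρ hside hc' rfl]
        exact hmem
      · exact absurd ⟨c, hc⟩ hn
    · exact mem_wordAct_direct.2 ⟨x, hx.mem_top List.prefix_rfl, rfl⟩

/-- The hypothesis on `m` is conditional because adding the inverse letter may create the inverse of
a relation. In that case the condition holds for every element, as the relation acts by zero. -/
theorem Formula.of_inverse_cons (hρ : IsStringPresentation ρ) (hside : IsSidePartition ρ side)
    {a : Quiver.Total V} {E : List (Letter V)} (hS : a.left = S) (hi : side (.inverse a) = i)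
    (hE : IsInH ρ side a.right (-side (.direct a)) E) {m : M}
    (hm : IsInH ρ side S i (.inverse a :: E) → Formula K ρ side S i (.inverse a :: E) m) :
    Formula K ρ side a.right (-side (.direct a)) E (arrow K ρ a • m) := by
  obtain ⟨W, b, hW, hEW, hWb, hF⟩ := exists_formula_iff (K := K) (M := M) hρ hside hE
  refine (hF _).2 ⟨by rw [← mul_smul, vertex_mul_arrow], ?_⟩
  rw [← mem_wordAct_inverse]
  rcases hW.cons_or (l := .inverse a) hS hi with hH | ⟨r, hr, hr' | hr'⟩
  · have hm := hm (hH.prefix (List.cons_prefix_cons.2 ⟨rfl, hEW⟩))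
    rcases hWb with ⟨rfl, c, rfl⟩ | ⟨rfl, rfl, hn⟩
    · rcases hm.2 with ⟨c', hc', hmem⟩ | ⟨hn, -⟩
      · rw [IsInH.letter_unique hρ hside (C := .inverse a :: E) hH hc' rfl]
        exact hmem
      · exact absurd ⟨c, hH⟩ hn
    · exact hm.mem_top List.prefix_rfl
  · obtain ⟨b, hb⟩ := exists_of_map_prefix_cons (hρ.ne_nil hr) hr'
    cases hb
  · exact mem_wordAct_of_inverse_prefix hr hr' _ _

theorem Formula.inverse_cons (hρ : IsStringPresentation ρ) (hside : IsSidePartition ρ side)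
    {a : Quiver.Total V} {E : List (Letter V)} (h : IsInH ρ side S i (.inverse a :: E)) {m : M}
    (hm : vertex K ρ S • m = m)
    (hx : Formula K ρ side a.right (-side (.direct a)) E (arrow K ρ a • m)) :
    Formula K ρ side S i (.inverse a :: E) m := by
  obtain ⟨W, b, hW, -, hWb, hF⟩ := exists_formula_iff (K := K) (M := M) hρ hside h
  refine (hF _).2 ⟨hm, ?_⟩
  rcases hWb with ⟨rfl, c, rfl⟩ | ⟨rfl, rfl, hn⟩
  · have hc := IsInH.tail (E := E ++ [.inverse c]) hρ hside hW
    rcases hx.2 with ⟨c', hc', hmem⟩ | ⟨hn, -⟩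
    · refine mem_wordAct_inverse.2 ?_
      change _ ∈ wordAct K ρ (E ++ [.inverse c]) _
      rw [hc.letter_unique hρ hside hc' rfl]
      exact hmem
    · exact absurd ⟨c, hc⟩ hn
  · exact mem_wordAct_inverse.2 (hx.mem_top List.prefix_rfl)

/-- If `m` has an infinite string with first letter `l`, there is a nonzero element on which
`l` connects, and whose divisibility is governed by the rest of the string. -/
theorem exists_strip (hρ : IsStringPresentation ρ) (hside : IsSidePartition ρ side)
    (hM : IsPureInjective.{uK, max uK uV uE, uM, uI, uN} K (BoundQuiverAlgebra K ρ) M)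
    {m : M} (h0 : m ≠ 0) (hm : vertex K ρ S • m = m) {s : HHat ρ side S i}
    (hs : IsStringOf K ρ side S i m s) {l : Letter V} (hl : s.1.get? 0 = some l)
    {t : HHat ρ side l.rightEnd (-side l.inv)} (ht : ∀ n, t.1.get? n = s.1.get? (n + 1)) :
    ∃ m' : M, m' ≠ 0 ∧ vertex K ρ l.rightEnd • m' = m' ∧
      (∀ E hE, HHat.ofList E hE < t → Formula K ρ side l.rightEnd (-side l.inv) E m') ∧
      ∀ E hE, t < HHat.ofList E hE → ¬ Formula K ρ side l.rightEnd (-side l.inv) E m' := by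
  let := HHat.linearOrder hρ hside S i
  have hlH : IsInH ρ side S i [l] := s.isInH_concat hl
  obtain ⟨hS, hi⟩ := hlH.2 _ rfl
  have hag : ∀ {E : List (Letter V)} {n : ℕ}, (∀ k < n, E[k]? = t.1.get? k) →
      ∀ k < n + 1, (l :: E)[k]? = s.1.get? k := by
    intro E n h k hk
    cases k with
    | zero => exact hl.symm
    | succ k => rw [List.getElem?_cons_succ, h k (by omega), ht]
  have hrank : ∀ {n : ℕ}, letterRank (t.1.get? n) = letterRank (s.1.get? (n + 1)) :=
    fun {n} => by rw [ht]
  have hlt : ∀ E (hE : IsInH ρ side l.rightEnd (-side l.inv) E)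
      (hlE : IsInH ρ side S i (l :: E)), HHat.ofList E hE < t → HHat.ofList _ hlE < s := by
    rintro E hE hlE ⟨n, hn, hn'⟩
    simp only [HHat.get?_ofList] at hn hn'
    exact ⟨n + 1, fun k hk => by rw [HHat.get?_ofList]; exact hag hn k hk,
      by rw [HHat.get?_ofList, List.getElem?_cons_succ, ← hrank]; exact hn'⟩
  have hgt : ∀ E (hE : IsInH ρ side l.rightEnd (-side l.inv) E)
      (hlE : IsInH ρ side S i (l :: E)), t < HHat.ofList E hE → s < HHat.ofList _ hlE := by
    rintro E hE hlE ⟨n, hn, hn'⟩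
    simp only [HHat.get?_ofList] at hn hn'
    exact ⟨n + 1, fun k hk => by
      rw [HHat.get?_ofList]; exact (hag (fun k hk => (hn k hk).symm) k hk).symm,
      by rw [HHat.get?_ofList, List.getElem?_cons_succ, ← hrank]; exact hn'⟩
  cases l with
  | direct a =>
    have hcons : ∀ E (hE : IsInH ρ side a.left (-side (.inverse a)) E),
        HHat.ofList E hE < t → IsInH ρ side S i (.direct a :: E) := by
      rintro E hE ⟨n, hn, hn'⟩
      simp only [HHat.get?_ofList] at hn hn'
      rcases hE.cons_or (l := .direct a) hS hi with hH | ⟨r, hr, hr' | hr'⟩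
      · exact hH
      · exact absurd hr' (s.not_direct_prefix (hag hn)
          (by rw [List.getElem?_cons_succ, ← hrank]; exact hn') hr)
      · obtain ⟨b, hb⟩ := exists_of_map_prefix_cons
          (List.reverse_eq_nil_iff.not.2 (hρ.ne_nil hr)) hr'
        cases hb
    -- The string exceeds the empty word, so `m` satisfies the formula of a word beginning with a
    -- direct letter, which can only be `a`. Hence `m` is in the image of `a`.
    obtain ⟨x₀, hx₀, hx₀m⟩ : ∃ x₀, vertex K ρ a.left • x₀ = x₀ ∧ arrow K ρ a • x₀ = m := by
      have hnil : HHat.ofList [] (isInH_nil hρ) < s := ⟨0, by simp, by simp [hl, letterRank]⟩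
      obtain ⟨D, hD, ⟨n, hn, hn'⟩, hF⟩ := hs.exists_gt hρ hside hnil
      simp only [HHat.get?_ofList, List.getElem?_nil] at hn hn'
      obtain ⟨b, hb⟩ := letterRank_eq_one hn'
      obtain rfl : n = 0 := by
        by_contra hne
        have := hn 0 (by omega)
        rw [eq_comm, List.getElem?_eq_none_iff] at this
        rw [List.getElem?_eq_none (by omega)] at hb
        cases hb
      have hpre : [Letter.direct b] <+: D := take_concat_prefix hb
      have := IsInH.letter_unique hρ hside (C := []) (hD.prefix hpre) hlH rfl
      rw [this] at hpre
      obtain ⟨x, -, hx⟩ := mem_wordAct_direct.1 (hF.mem_top hpre)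
      exact ⟨vertex K ρ a.left • x, by rw [← mul_smul, vertex_mul_self],
        by rw [← mul_smul, arrow_mul_vertex, hx]⟩
    -- The coset of `x₀` modulo the kernel of `a` is the solution set of `a y = m`. Each formula
    -- below `t` has a solution in it, hence all have a common one.
    obtain ⟨y, hy, hyx, hyT⟩ := hM.exists_forall_formula hρ hside (S := a.left)
      (i := -side (.inverse a)) (E := [.inverse a]) (by simp [Letter.leftEnd]) false hx₀
      {E | ∃ hE, HHat.ofList E hE < t} (fun E hE => hE.1) (by
        rintro E ⟨hE, hEt⟩
        have hH := hcons E hE hEt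
        obtain ⟨x, hx, hxF⟩ :=
          (hs.formula hρ hside hH (hlt E hE hH hEt)).exists_of_direct_cons hρ hside hH
        refine ⟨x, ?_, hxF⟩
        change arrow K ρ a • (x - x₀) = 0
        rw [smul_sub, hx, hx₀m, sub_self])
    have hym : arrow K ρ a • y = m := by
      have : arrow K ρ a • (y - x₀) = 0 := hyx
      rw [smul_sub, hx₀m, sub_eq_zero] at this
      exact this
    refine ⟨y, ?_, hy, fun E hE h => hyT E ⟨hE, h⟩, fun E hE h hF => ?_⟩
    · rintro rfl
      exact h0 (by rw [← hym, smul_zero])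
    · rcases hE.cons_or (l := .direct a) hS hi with hH | ⟨r, hr, hr' | hr'⟩
      · have := hF.direct_cons hρ hside hH
        rw [hym] at this
        exact absurd (hs.le hH this) (not_le.2 (hgt E hE hH h))
      · exact h0 (eq_zero_of_direct_prefix hr hr'
          (mem_wordAct_direct.2 ⟨y, hF.mem_top List.prefix_rfl, hym⟩))
      · obtain ⟨b, hb⟩ := exists_of_map_prefix_cons
          (List.reverse_eq_nil_iff.not.2 (hρ.ne_nil hr)) hr'
        cases hb
  | inverse a =>
    refine ⟨arrow K ρ a • m, fun hz => ?_, ?_, fun E hE h => ?_, fun E hE h hF => ?_⟩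
    -- If `a m = 0`, then `m` would satisfy the formula of the empty word, which lies above a string
    -- beginning with an inverse letter.
    · have hnil : s < HHat.ofList [] (isInH_nil hρ) := ⟨0, by simp, by simp [hl, letterRank]⟩
      refine absurd (hs.le (isInH_nil hρ) ⟨hm, Or.inl ⟨a, hlH, ?_⟩⟩) (not_le.2 hnil)
      exact hz
    · change vertex K ρ a.right • _ = _
      rw [← mul_smul, vertex_mul_arrow]
    · exact Formula.of_inverse_cons hρ hside hS hi hE fun hH =>
        hs.formula hρ hside hH (hlt E hE hH h)
    · have hH : IsInH ρ side S i (.inverse a :: E) := by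
        obtain ⟨n, hn, hn'⟩ := h
        simp only [HHat.get?_ofList] at hn hn'
        rcases hE.cons_or (l := .inverse a) hS hi with hH | ⟨r, hr, hr' | hr'⟩
        · exact hH
        · obtain ⟨b, hb⟩ := exists_of_map_prefix_cons (hρ.ne_nil hr) hr'
          cases hb
        · exact absurd hr' (s.not_inverse_prefix (hag fun k hk => (hn k hk).symm)
            (by rw [List.getElem?_cons_succ, ← hrank]; exact hn') hr)
      exact absurd (hs.le hH (hF.inverse_cons hρ hside hH hm)) (not_le.2 (hgt E hE hH h))

/-- The infinite word `w` is the string of a nonzero element of `M`. -/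
def IsRealized (K : Type uK) [Field K] {V : Type uV} [Quiver.{uE} V] [Fintype V]
    (ρ : Set (List (Quiver.Total V))) (M : Type uM) [AddCommGroup M]
    [Module (BoundQuiverAlgebra K ρ) M] (side : Letter V → ℤˣ) (w : ℕ → Letter V) : Prop :=
  ∃ (S : V) (i : ℤˣ) (m : M) (s : HHat ρ side S i), m ≠ 0 ∧ vertex K ρ S • m = m ∧
    IsStringOf K ρ side S i m s ∧ ∀ n, s.1.get? n = some (w n)

/-- `exists_strip` decides only the formulas of finite words below and above the tail. This
determines the string because by `hinf` it is infinite, and a finite word separates any two distinct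
infinite ones. -/
theorem IsRealized.tail (hρ : IsStringPresentation ρ) (hside : IsSidePartition ρ side)
    (hM : IsPureInjective.{uK, max uK uV uE, uM, uI, uN} K (BoundQuiverAlgebra K ρ) M)
    (hinf : ∀ (S : V) (i : ℤˣ) (m : M) (s : HHat ρ side S i), m ≠ 0 → vertex K ρ S • m = m →
      IsStringOf K ρ side S i m s → ∀ n, s.1.get? n ≠ none)
    {w : ℕ → Letter V} (hw : IsRealized K ρ M side w) :
    IsRealized K ρ M side fun n => w (n + 1) := by
  obtain ⟨S, i, m, s, h0, hm, hs, hsw⟩ := hw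
  have htake : ∀ n, s.1.take (n + 1) = w 0 :: s.1.tail.take n := by
    intro n
    apply List.ext_getElem?
    rintro (_ | k)
    · rw [Stream'.Seq.getElem?_take, if_pos (by omega), hsw]
      rfl
    · rw [Stream'.Seq.getElem?_take, List.getElem?_cons_succ, Stream'.Seq.getElem?_take,
        Stream'.Seq.get?_tail]
      simp
  let t : HHat ρ side (w 0).rightEnd (-side (w 0).inv) :=
    ⟨s.1.tail, fun n => (htake n ▸ s.2 (n + 1)).tail hρ hside⟩
  have ht : ∀ n, t.1.get? n = s.1.get? (n + 1) := fun n => Stream'.Seq.get?_tail _ _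
  obtain ⟨m', h0', hm', h1, h2⟩ := exists_strip hρ hside hM h0 hm hs (hsw 0) ht
  obtain ⟨s', hs'⟩ := exists_isStringOf hρ hside (-side (w 0).inv) hm'
  have hs'inf := hinf _ _ _ _ h0' hm' hs'
  have htinf : ∀ n, t.1.get? n ≠ none := fun n => by rw [ht, hsw]; simp
  let := HHat.linearOrder hρ hside (w 0).rightEnd (-side (w 0).inv)
  have heq : s' = t := by
    rcases lt_trichotomy s' t with h | h | h
    · obtain ⟨E, hE, hsE, hEt⟩ := HHat.exists_between hs'inf htinf h
      exact absurd (hs'.le hE (h1 E hE hEt)) (not_le.2 hsE)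
    · exact h
    · obtain ⟨E, hE, htE, hEs⟩ := HHat.exists_between htinf hs'inf h
      exact absurd (hs'.formula hρ hside hE hEs) (h2 E hE htE)
  exact ⟨_, _, m', s', h0', hm', hs', fun n => by rw [heq, ht, hsw]⟩

end Strip

end StringAlg

namespace StringAlg

/-! ### Bands, domesticity, and maximal infinite words -/

section Bands

variable {V : Type uV} [Quiver.{uE} V] {ρ : Set (List (Quiver.Total V))}

theorem infix_append_cases {α : Type*} {L A B : List α} (h : L <:+: A ++ B) :
    L <:+: A ∨ L <:+: B ∨ ((∃ x ∈ A.getLast?, x ∈ L) ∧ ∃ y ∈ B.head?, y ∈ L) := by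
  obtain ⟨s, t, h⟩ := h
  rcases List.append_eq_append_iff.1 h with ⟨a, ha, -⟩ | ⟨c, hc, rfl⟩
  · exact Or.inl ⟨s, a, ha.symm⟩
  · rcases List.append_eq_append_iff.1 hc with ⟨a, rfl, rfl⟩ | ⟨d, -, rfl⟩
    · rcases List.eq_nil_or_concat' a with rfl | ⟨a, x, rfl⟩
      · exact Or.inr (Or.inl ⟨[], t, by simp⟩)
      · cases c with
        | nil => exact Or.inl ⟨s, [], by simp⟩
        | cons y c =>
          exact Or.inr (Or.inr ⟨⟨x, by simp [← List.append_assoc], by simp⟩, y, by simp, by simp⟩)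
    · exact Or.inr (Or.inl ⟨d, t, rfl⟩)

/-- Relations use only direct letters and their inverses only inverse letters, so neither can cross
the junction of an inverse with a direct letter. -/
theorem IsString.append {A B : List (Letter V)} {b c : Quiver.Total V} (hA : IsString ρ A)
    (hB : IsString ρ B) (hAc : A.getLast? = some (.inverse c)) (hBb : B.head? = some (.direct b))
    (hcb : c ≠ b) (hr : c.right = b.right) : IsString ρ (A ++ B) := by
  refine ⟨List.isChain_append.2 ⟨hA.1, hB.1, ?_⟩, fun r hrρ => ⟨fun h => ?_, fun h => ?_⟩⟩
  · intro x hx y hy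
    rw [hAc] at hx
    rw [hBb] at hy
    cases hx
    cases hy
    refine ⟨hr, fun h => hcb ?_⟩
    injection h with h
    exact h.symm
  · rcases infix_append_cases h with h | h | ⟨⟨x, hx, hx'⟩, -⟩
    · exact (hA.2 r hrρ).1 h
    · exact (hB.2 r hrρ).1 h
    · rw [hAc] at hx
      cases hx
      simp at hx'
  · rcases infix_append_cases h with h | h | ⟨-, x, hx, hx'⟩
    · exact (hA.2 r hrρ).2 h
    · exact (hB.2 r hrρ).2 h
    · rw [hBb] at hx
      cases hx
      simp at hx'

/-- The string `W` begins with the arrow `b` and ends with the inverse of an arrow `c ≠ b'` that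
has the same target as `b'`, so that it can be continued by any string beginning with `b'`. -/
def Connects (ρ : Set (List (Quiver.Total V))) (b b' : Quiver.Total V) (W : List (Letter V)) :
    Prop :=
  IsString ρ W ∧ W.head? = some (.direct b) ∧
    ∃ c, W.getLast? = some (.inverse c) ∧ c ≠ b' ∧ c.right = b'.right

theorem Connects.trans {b b' b'' : Quiver.Total V} {W W' : List (Letter V)}
    (h : Connects ρ b b' W) (h' : Connects ρ b' b'' W') : Connects ρ b b'' (W ++ W') := by
  obtain ⟨h1, h2, c, h3, h4, h5⟩ := h
  obtain ⟨h1', h2', c', h3', h4', h5'⟩ := h'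
  exact ⟨h1.append h1' h3 h2' h4 h5, by simp [List.head?_append, h2], c',
    by simp [List.getLast?_append, h3'], h4', h5'⟩

theorem flatten_replicate_add {α : Type*} (k l : ℕ) (v : List α) :
    (List.replicate (k + l) v).flatten =
      (List.replicate k v).flatten ++ (List.replicate l v).flatten := by
  rw [List.replicate_add, List.flatten_append]

theorem flatten_replicate_mul {α : Type*} (k l : ℕ) (v : List α) :
    (List.replicate k (List.replicate l v).flatten).flatten =
      (List.replicate (k * l) v).flatten := by
  induction k with
  | zero => simp
  | succ k ih => rw [Nat.succ_mul, flatten_replicate_add, flatten_replicate_add, ih]; simp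

/-- A closed string at `b` is a power of a band beginning with `b`. -/
theorem Connects.exists_band {b : Quiver.Total V} {W : List (Letter V)} (h : Connects ρ b b W) :
    ∃ (C : List (Letter V)) (k : ℕ), IsBand ρ C ∧ C.head? = some (.direct b) ∧
      W = (List.replicate k C).flatten := by
  classical
  obtain ⟨h1, h2, c, h3, h4, h5⟩ := h
  -- The band is a shortest word `P` of which `W` is a power. It is primitive, since a proper root
  -- of `P` would be a shorter root of `W`.
  have hex : ∃ n : ℕ, ∃ (P : List (Letter V)) (k : ℕ), P.length = n ∧
      W = (List.replicate k P).flatten := ⟨_, W, 1, rfl, by simp⟩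
  obtain ⟨P, k, hP, hW⟩ := Nat.find_spec hex
  have hmin := fun m => Nat.find_min hex (m := m)
  rw [← hP] at hmin
  have hW0 : W ≠ [] := by
    rintro rfl
    simp at h2
  obtain ⟨k, rfl⟩ : ∃ k', k = k' + 1 := by
    refine Nat.exists_eq_succ_of_ne_zero ?_
    rintro rfl
    exact hW0 (by simpa using hW)
  have hP0 : P ≠ [] := by
    rintro rfl
    exact hW0 (by simpa using hW)
  have hpre : P <+: W := ⟨(List.replicate k P).flatten, by
    rw [hW, Nat.add_comm, flatten_replicate_add]; simp⟩
  have hsuf : P <:+ W := ⟨(List.replicate k P).flatten, by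
    rw [hW, flatten_replicate_add]; simp⟩
  have hhead : P.head? = some (.direct b) := by
    obtain ⟨t, ht⟩ := hpre
    rwa [← ht, List.head?_append_of_ne_nil _ hP0] at h2
  have hlast : P.getLast? = some (.inverse c) := by
    obtain ⟨t, ht⟩ := hsuf
    rwa [← ht, List.getLast?_append_of_ne_nil _ hP0] at h3
  refine ⟨P, k + 1, ⟨h1.infix hpre.isInfix, ⟨b, c, ?_⟩, fun v j hj hv => ?_⟩, hhead, hW⟩
  · obtain ⟨P', rfl⟩ := List.head?_eq_some_iff.1 hhead
    rcases List.eq_nil_or_concat' P' with rfl | ⟨u, l, rfl⟩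
    · simp at hlast
    · rw [← List.cons_append, List.getLast?_concat] at hlast
      cases hlast
      exact ⟨u, h4.symm, h5.symm, rfl⟩
  · have hlen : P.length = j * v.length := by rw [hv]; simp
    have hpos : 0 < P.length := List.length_pos_iff.2 hP0
    have hv0 : 0 < v.length := by
      rcases Nat.eq_zero_or_pos v.length with h | h
      · rw [h] at hlen; omega
      · exact h
    refine hmin v.length ?_ ⟨v, (k + 1) * j, rfl, ?_⟩
    · rw [hlen]; nlinarith
    · rw [← flatten_replicate_mul, ← hv, hW]

/-- In the domestic case, of two closed strings at `b` one is an initial subword of the other. -/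
theorem Connects.prefix_or_prefix (hdom : IsDomestic ρ) {b : Quiver.Total V}
    {W W' : List (Letter V)} (h : Connects ρ b b W) (h' : Connects ρ b b W') :
    W <+: W' ∨ W' <+: W := by
  obtain ⟨C, k, hC, hCb, rfl⟩ := h.exists_band
  obtain ⟨C', k', hC', hCb', rfl⟩ := h'.exists_band
  obtain rfl := hdom b C C' hC hC' hCb hCb'
  rcases le_total k k' with hk | hk
  · left
    obtain ⟨d, rfl⟩ := Nat.exists_eq_add_of_le hk
    rw [flatten_replicate_add]
    exact List.prefix_append _ _
  · right
    obtain ⟨d, rfl⟩ := Nat.exists_eq_add_of_le hk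
    rw [flatten_replicate_add]
    exact List.prefix_append _ _

theorem IsStringPresentation.finite_arrows [Finite V] (hρ : IsStringPresentation ρ) :
    Finite (Quiver.Total V) := by
  rw [← Set.finite_univ_iff]
  have : (Set.univ : Set (Quiver.Total V)) = ⋃ x : V, {a | a.right = x} := by
    ext a
    simp
  rw [this]
  exact Set.finite_iUnion fun x => Set.finite_of_encard_le_coe (k := 2) (hρ.ingoing x)

/-! ### Infinite words -/

/-- The arrow `b` stands, after an inverse letter, at arbitrarily late places of `w`. -/
def Recurs (w : ℕ → Letter V) (b : Quiver.Total V) : Prop :=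
  ∀ N, ∃ k, N ≤ k ∧ (∃ c, w k = .inverse c) ∧ w (k + 1) = .direct b

/-- Runs of letters of one kind have bounded length. The turn sits just before the first direct
letter that follows an inverse letter. -/
theorem exists_turn (hρ : IsStringPresentation ρ) {w : ℕ → Letter V}
    (hw : ∀ N n, IsString ρ ((List.range n).map fun k => w (N + k))) (N : ℕ) :
    ∃ k, N ≤ k ∧ (∃ c, w k = .inverse c) ∧ ∃ b, w (k + 1) = .direct b := by
  classical
  obtain ⟨n, hn⟩ := exists_length_bound hρ
  have hinv : ∃ j, N ≤ j ∧ ∃ c, w j = .inverse c := by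
    by_contra! hcon
    have : ∀ k, ∃ a, w (N + k) = .direct a := fun k => by
      cases h : w (N + k) with
      | direct a => exact ⟨a, rfl⟩
      | inverse c => exact absurd h (hcon _ (by omega) c)
    choose a ha using this
    have h1 := hw N n
    rw [show (List.range n).map (fun k => w (N + k)) = ((List.range n).map a).map .direct by
      simp [ha]] at h1
    simpa using (hn _).1 h1
  obtain ⟨j, hj, c, hc⟩ := hinv
  have hdir : ∃ k, ∃ b, w (j + k) = .direct b := by
    by_contra! hcon
    have : ∀ k, ∃ a, w (j + k) = .inverse a := fun k => by
      cases h : w (j + k) with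
      | direct a => exact absurd h (hcon _ _)
      | inverse c => exact ⟨c, rfl⟩
    choose a ha using this
    have h1 := hw j n
    rw [show (List.range n).map (fun k => w (j + k)) = ((List.range n).map a).map .inverse by
      simp [ha]] at h1
    simpa using (hn _).2 h1
  have hspec := Nat.find_spec hdir
  have hmin := fun m => Nat.find_min hdir (m := m)
  generalize Nat.find hdir = k at hspec hmin
  cases k with
  | zero =>
    obtain ⟨b, hb⟩ := hspec
    rw [Nat.add_zero, hc] at hb
    cases hb
  | succ k =>
    refine ⟨j + k, by omega, ?_, hspec⟩
    cases h : w (j + k) with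
    | direct a => exact absurd ⟨a, h⟩ (hmin k (by omega))
    | inverse c => exact ⟨c, rfl⟩

theorem exists_recurs [Finite V] (hρ : IsStringPresentation ρ) {w : ℕ → Letter V}
    (hw : ∀ N n, IsString ρ ((List.range n).map fun k => w (N + k))) : ∃ b, Recurs w b := by
  have := hρ.finite_arrows
  by_contra! hcon
  unfold Recurs at hcon
  push Not at hcon
  choose N hN using hcon
  obtain ⟨B, hB⟩ := (Set.finite_range N).bddAbove
  obtain ⟨k, hk, hc, b, hb⟩ := exists_turn hρ hw B
  exact hN b k ((hB ⟨b, rfl⟩).trans hk) hc hb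

theorem connects_of_turn (hρ : IsStringPresentation ρ) {w : ℕ → Letter V}
    (hw : ∀ n, IsString ρ ((List.range n).map w)) {b b' c : Quiver.Total V} {k : ℕ}
    (h0 : w 0 = .direct b) (hk : w k = .inverse c) (hk' : w (k + 1) = .direct b') :
    Connects ρ b b' ((List.range (k + 1)).map w) := by
  have h2 : IsString ρ [w k, w (k + 1)] := (hw (k + 2)).infix
    ⟨(List.range k).map w, [], by simp [List.range_succ]⟩
  rw [isString_pair_iff hρ, hk, hk'] at h2
  refine ⟨hw _, by simp [List.range_succ_eq_map, h0], c, by simp [List.range_succ, hk], ?_, h2.1⟩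
  rintro rfl
  exact h2.2.1 rfl

/-- In the domestic case, a nonempty set of infinite words that is closed under passing to final
subwords contains a word with no larger word in the set. -/
theorem exists_maximal_word [Finite V] (hρ : IsStringPresentation ρ) (hdom : IsDomestic ρ)
    {X : Set (ℕ → Letter V)} (hne : X.Nonempty)
    (hstr : ∀ w ∈ X, ∀ n, IsString ρ ((List.range n).map w))
    (htail : ∀ w ∈ X, (fun n => w (n + 1)) ∈ X) :
    ∃ w ∈ X, ∀ w' ∈ X, ∀ n, (∀ k < n, w k = w' k) → ∀ c a, w n = .inverse c →
      w' n ≠ .direct a := by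
  classical
  have := hρ.finite_arrows
  have hdrop : ∀ w ∈ X, ∀ N, (fun n => w (N + n)) ∈ X := by
    intro w hw N
    induction N with
    | zero => simpa using hw
    | succ N ih =>
      have := htail _ ih
      simpa only [Nat.add_assoc, Nat.add_comm 1, Nat.succ_eq_add_one] using this
  have hstr' : ∀ w ∈ X, ∀ N n, IsString ρ ((List.range n).map fun k => w (N + k)) :=
    fun w hw N n => hstr _ (hdrop w hw N) n
  let B : Set (Quiver.Total V) := {b | ∃ w ∈ X, w 0 = .direct b ∧ Recurs w b}
  have hB : ∀ w ∈ X, ∀ b N, Recurs w b → ∃ k, N ≤ k ∧ (∃ c, w k = .inverse c) ∧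
      w (k + 1) = .direct b ∧ b ∈ B := by
    intro w hw b N hb
    obtain ⟨k, hk, hc, hkb⟩ := hb N
    refine ⟨k, hk, hc, hkb, _, hdrop w hw (k + 1), hkb, fun N' => ?_⟩
    obtain ⟨j, hj, hc', hj'⟩ := hb (k + 1 + N')
    obtain ⟨d, rfl⟩ := Nat.exists_eq_add_of_le hj
    exact ⟨N' + d, by omega, by simpa only [Nat.add_assoc] using hc',
      by simpa only [Nat.add_assoc] using hj'⟩
  let R : Quiver.Total V → Set (Quiver.Total V) := fun b => {b' ∈ B | ∃ W, Connects ρ b b' W}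
  have hBne : B.Nonempty := by
    obtain ⟨w, hw⟩ := hne
    obtain ⟨b, hb⟩ := exists_recurs hρ (hstr' w hw)
    obtain ⟨-, -, -, -, hbB⟩ := hB w hw b 0 hb
    exact ⟨b, hbB⟩
  -- An arrow with the fewest reachable arrows lies in a terminal strongly connected component:
  -- everything in `B` that is reachable from it leads back to it.
  obtain ⟨b, hbB, hbmin⟩ := Set.exists_min_image B (fun b => (R b).ncard) B.toFinite hBne
  have hback : ∀ b' ∈ B, ∀ W, Connects ρ b b' W → ∃ W', Connects ρ b' b W' := by
    intro b' hb' W hW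
    have hsub : R b' ⊆ R b := fun d ⟨hd, W', hW'⟩ => ⟨hd, _, hW.trans hW'⟩
    have heq := Set.eq_of_subset_of_ncard_le hsub (hbmin b' hb') (Set.toFinite _)
    have hself : b ∈ R b := by
      obtain ⟨w, hw, hw0, hrec⟩ := hbB
      obtain ⟨k, -, ⟨c, hc⟩, hk⟩ := hrec 0
      exact ⟨⟨w, hw, hw0, hrec⟩, _, connects_of_turn hρ (hstr w hw) hw0 hc hk⟩
    rw [← heq] at hself
    exact hself.2
  obtain ⟨w, hw, hw0, hrec⟩ := hbB
  refine ⟨w, hw, fun w' hw' n hag c a hc ha => ?_⟩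
  have hn : 0 < n := by
    rcases Nat.eq_zero_or_pos n with rfl | h
    · rw [hw0] at hc
      cases hc
    · exact h
  have hw0' : w' 0 = .direct b := by rw [← hag 0 hn, hw0]
  obtain ⟨b', hb'⟩ := exists_recurs hρ (hstr' w' hw')
  obtain ⟨k, hk, ⟨d, hd⟩, hkb, hb'B⟩ := hB w' hw' b' n hb'
  -- An initial part of `w'` extending beyond position `n` leads from `b` to `b'`, and `W'` leads
  -- back. An initial part of `w` beyond `n` is also closed at `b`. By domesticity one of the two
  -- closed words is a prefix of the other, although they differ at `n`.
  have hconn := connects_of_turn hρ (hstr w' hw') hw0' hd hkb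
  obtain ⟨W', hW'⟩ := hback b' hb'B _ hconn
  obtain ⟨q, hq, ⟨e, he⟩, hqb⟩ := hrec n
  have hconn' := connects_of_turn hρ (hstr w hw) hw0 he hqb
  have h1 : ((List.range (k + 1)).map w' ++ W')[n]? = some (.direct a) := by
    rw [List.getElem?_append_left (by simp; omega), List.getElem?_map,
      List.getElem?_range (by omega), Option.map_some, ha]
  have h2 : ((List.range (q + 1)).map w)[n]? = some (.inverse c) := by
    rw [List.getElem?_map, List.getElem?_range (by omega), Option.map_some, hc]
  have h3 : some (Letter.direct a) = some (Letter.inverse c) := by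
    rcases (hconn.trans hW').prefix_or_prefix hdom hconn' with ⟨t, ht⟩ | ⟨t, ht⟩
    · rw [← h1, ← h2, ← ht, List.getElem?_append_left (l₂ := t)]
      simp; omega
    · rw [← h1, ← h2, ← ht, List.getElem?_append_left (l₂ := t)]
      simp; omega
  cases h3

end Bands

end StringAlg

/-! ### Existence of a homogeneous element -/

theorem corollary4p4 {K : Type uK} [Field K]
    {V : Type uV} [Quiver.{uE} V] [Fintype V]
    (ρ : Set (List (Quiver.Total V)))
    (hρ : StringAlg.IsStringPresentation ρ) (hdom : StringAlg.IsDomestic ρ)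
    (side : StringAlg.Letter V → ℤˣ) (hside : StringAlg.IsSidePartition ρ side)
    {M : Type uM} [AddCommGroup M] [Module (StringAlg.BoundQuiverAlgebra K ρ) M] [Nontrivial M]
    (hM : StringAlg.IsPureInjective.{uK, max uK uV uE, uM, uI, uN} K
      (StringAlg.BoundQuiverAlgebra K ρ) M) :
    ∃ (S : V) (m : M), StringAlg.IsHomogeneous K ρ side S m := by
  open StringAlg in
  by_contra hcon
  have hnot : ∀ (S : V) (i : ℤˣ) (m : M), ¬ IsHomogeneousOn K ρ side S i (-i) m := by
    intro S i m h
    rcases Int.units_eq_one_or i with rfl | rfl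
    · exact hcon ⟨S, m, h.symm⟩
    · exact hcon ⟨S, m, h⟩
  have hinf : ∀ (S : V) (i : ℤˣ) (m : M) (s : HHat ρ side S i), m ≠ 0 → vertex K ρ S • m = m →
      IsStringOf K ρ side S i m s → ∀ n, s.1.get? n ≠ none := by
    intro S i m s h0 hm hs n hn
    have ht : s.1.Terminates := ⟨n, hn⟩
    have hD : s.1 = Stream'.Seq.ofList (s.1.toList ht) := (Stream'.Seq.ofList_toList _ _).symm
    have hH := s.isInH_of_eq_ofList hD
    rw [show s = HHat.ofList _ hH from Subtype.ext hD] at hs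
    obtain ⟨m', hm'⟩ := exists_isHomogeneousOn_of_finite hρ hside hM h0 hm hH hs (-i)
    exact hnot S i m' hm'
  have hreal : ∀ (S : V) (i : ℤˣ) (m : M) (s : HHat ρ side S i), m ≠ 0 → vertex K ρ S • m = m →
      IsStringOf K ρ side S i m s → ∃ w, IsRealized K ρ M side w ∧ ∀ n, s.1.get? n = some (w n) := by
    intro S i m s h0 hm hs
    choose w hw using fun n => Option.ne_none_iff_exists'.1 (hinf S i m s h0 hm hs n)
    exact ⟨w, ⟨S, i, m, s, h0, hm, hs, hw⟩, hw⟩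
  obtain ⟨w, ⟨S, i, m, s, h0, hm, hs, hsw⟩, hmax⟩ := exists_maximal_word hρ hdom
    (X := {w | IsRealized K ρ M side w})
    (by
      obtain ⟨S, m, h0, hm⟩ := exists_vertex_smul_ne_zero (K := K) (ρ := ρ) (M := M)
      obtain ⟨s, hs⟩ := exists_isStringOf hρ hside 1 hm
      obtain ⟨w, hw, -⟩ := hreal S 1 m s h0 hm hs
      exact ⟨w, hw⟩)
    (by
      rintro w ⟨S, i, m, s, -, -, -, hsw⟩ n
      have : (List.range n).map w = s.1.take n := by
        apply List.ext_getElem?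
        intro k
        rw [Stream'.Seq.getElem?_take, List.getElem?_map]
        split_ifs with hk
        · rw [List.getElem?_range hk, hsw]
          rfl
        · rw [List.getElem?_eq_none (by simpa using hk)]
          rfl
      rw [this]
      exact (s.2 n).1)
    (fun w hw => IsRealized.tail hρ hside hM hinf hw)
  obtain ⟨t, ht⟩ := exists_isStringOf hρ hside (-i) hm
  refine hnot S i m ⟨h0, hm, s, t, hs, ht, ?_⟩
  rintro ⟨x, hx, u, v, hu, hv, hsu, htv⟩
  -- For `x = 0` the other string would not increase. Being nonzero, `x` has an infinite string,
  -- which belongs to the set in which `w` is maximal.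
  have hx0 : x ≠ 0 := by
    rintro rfl
    rw [sub_zero] at hv
    obtain ⟨n, -, hn⟩ := hv.unique hρ hside ht ▸ htv
    exact lt_irrefl _ hn
  obtain ⟨w', hw', huw⟩ := hreal S i x u hx0 hx hu
  obtain ⟨n, hn, hn'⟩ := hsu
  simp only [hsw, huw, Option.some.injEq] at hn hn'
  -- Two infinite words never differ at an end of word, so the larger one has a direct letter where
  -- `w` has an inverse one, which maximality forbids.
  cases h1 : w n with
  | direct a =>
    rw [h1] at hn'
    exact absurd hn' (not_lt.2 (letterRank_le_one _))
  | inverse c =>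
    cases h2 : w' n with
    | direct a => exact hmax w' hw' n hn c a h1 h2
    | inverse d =>
      rw [h1, h2] at hn'
      exact lt_irrefl _ hn'
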